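/- **Conventions.** A *stable abelian category* is an abelian category with an additive suspension autoequivalence $\Sigma$. Let $\mathfrak T$ be a triangulated category. A *stable homological functor* $F\colon\mathfrak T\to\mathfrak C$ is a functor to a stable abelian category such that $F(A)\to F(B)\to F(C)$ is exact for every exact triangle $A\to B\to C\to\Sigma A$, together with a natural isomorphism $F(\Sigma A)\cong\Sigma F(A)$; a *stable exact functor* between stable abelian categories is an exact functor with such a natural isomorphism. An *ideal* $\mathfrak I$ in $\mathfrak T$ is a family of subgroups $\mathfrak I(A,B)\subseteq\mathfrak T(A,B)$ closed under composition with arbitrary morphisms on both sides; it is *homological* if $\mathfrak I=\ker G:=\{f\mid G(f)=0\}$ for some stable homological functor $G$. A functor $G$ is *$\mathfrak I$-exact* if $G(f)=0$ for all $f\in\mathfrak I$. An $\mathfrak I$-exact stable homological functor $F\colon\mathfrak T\to\mathfrak C$ is *universal* if every $\mathfrak I$-exact stable homological functor $G\colon\mathfrak T\to\mathfrak C'$ factors as $G\cong\bar G\circ F$ (as stable functors) for a stable exact functor $\bar G\colon\mathfrak C\to\mathfrak C'$ that is unique up to natural isomorphism (of stable functors, compatible with the factorizations). An object $P$ of $\mathfrak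 T$ is *$\mathfrak I$-projective* if the functor $\mathfrak T(P,-)$ is $\mathfrak I$-exact; a morphism $f\colon A\to B$ is *$\mathfrak I$-epic* if $g\in\mathfrak I$ in an exact triangle $A\xrightarrow{f}B\xrightarrow{g}C\to\Sigma A$; *there are enough $\mathfrak I$-projective objects* if every object $A$ of $\mathfrak T$ admits an $\mathfrak I$-epic morphism $P\to A$ with $P$ $\mathfrak I$-projective. The *partial left adjoint* $F^\vdash$ of $F$ is defined on the full subcategory of those objects $A$ of $\mathfrak C$ for which the functor $B\mapsto\mathfrak C(A,F(B))$ on $\mathfrak T$ is corepresentable; $F^\vdash(A)$ is the corepresenting object, so that $\mathfrak T(F^\vdash(A),B)\cong\mathfrak C(A,F(B))$ naturally in $B$. **Theorem.** Let $\mathfrak T$ be a triangulated category in which idempotent morphisms split, let $\mathfrak I$ be a homological ideal in $\mathfrak T$, and let $F\colon\mathfrak T\to\mathfrak C$ be an $\mathfrak I$-exact stable homological functor into a stable abelian category $\mathfrak C$; let $\mathfrak{PC}$ be the full subcategory of projective objects of $\mathfrak C$. Then $F$ is the universal $\mathfrak I$-exact stable homological functor and there are enough $\mathfrak I$-projective objects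 in $\mathfrak T$ if and only if $\ker F=\mathfrak I$ and the following three conditions hold: * $\mathfrak C$ has enough projective objects; * the partial left adjoint $F^\vdash$ is defined on $\mathfrak{PC}$; * $F\circ F^\vdash(A)\cong A$ naturally in $A\in\mathfrak{PC}$, that is, the functor $F\circ F^\vdash|_{\mathfrak{PC}}$ is naturally isomorphic to the inclusion $\mathfrak{PC}\to\mathfrak C$. -/

import Mathlib

open CategoryTheory Limits Pretriangulated

universe w z u v u' v' u'' v''

/-- A stable additive category: an additive category with an additive suspension, given as an
autoequivalence. -/
class StableCategory (C : Type u) [Category.{v} C] [Preadditive C] where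
  /-- the suspension autoequivalence -/
  suspEquiv : C ≌ C
  additive : suspEquiv.functor.Additive

/-- The suspension functor `Σ` of a stable additive category. -/
abbrev susp (C : Type u) [Category.{v} C] [Preadditive C] [StableCategory C] : C ⥤ C :=
  (StableCategory.suspEquiv (C := C)).functor

/-- The suspension of a triangulated category is its shift by `1`. -/
noncomputable instance StableCategory.ofShift (T : Type u) [Category.{v} T] [Preadditive T]
    [HasShift T ℤ] [∀ n : ℤ, (shiftFunctor T n).Additive] : StableCategory T where
  suspEquiv := shiftEquiv T (1 : ℤ)
  additive := inferInstanceAs (shiftFunctor T (1 : ℤ)).Additive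

/-- A stable homological functor `T ⥤ C`: a homological functor together with a natural
isomorphism `F (Σ A) ≅ Σ (F A)`. -/
structure StableHomologicalFunctor (T : Type u) [Category.{v} T] [Preadditive T]
    [HasZeroObject T] [HasShift T ℤ] [∀ n : ℤ, (shiftFunctor T n).Additive] [Pretriangulated T]
    (C : Type u') [Category.{v'} C] [Abelian C] [StableCategory C] where
  functor : T ⥤ C
  isHomological : functor.IsHomological
  suspIso : susp T ⋙ functor ≅ functor ⋙ susp C

/-- A stable exact functor between stable abelian categories: an exact functor together with a
natural isomorphism `F (Σ X) ≅ Σ (F X)`. -/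
structure StableExactFunctor (C : Type u) [Category.{v} C] [Abelian C] [StableCategory C]
    (D : Type u') [Category.{v'} D] [Abelian D] [StableCategory D] where
  functor : C ⥤ D
  preservesFiniteLimits : PreservesFiniteLimits functor
  preservesFiniteColimits : PreservesFiniteColimits functor
  suspIso : susp C ⋙ functor ≅ functor ⋙ susp D

/-- An ideal in a preadditive category: a family of subgroups of the morphism groups that is closed
under composition with arbitrary morphisms on both sides. -/
@[ext]
structure MorphismIdeal (T : Type u) [Category.{v} T] [Preadditive T] where
  hom (A B : T) : AddSubgroup (A ⟶ B)
  comp_mem {A B B' D : T} (f : A ⟶ B) (g : B ⟶ B') (h : B' ⟶ D) :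
    g ∈ hom B B' → f ≫ g ≫ h ∈ hom A D

namespace MorphismIdeal

section Additive

variable {T : Type u} [Category.{v} T] [Preadditive T]

/-- The kernel of an additive functor: the ideal of all morphisms `f` with `F f = 0`. -/
def ker {C : Type u'} [Category.{v'} C] [Preadditive C] (F : T ⥤ C) [F.Additive] :
    MorphismIdeal T where
  hom A B := (F.mapAddHom (X := A) (Y := B)).ker
  comp_mem f g h hg := by
    have hg' : F.map g = 0 := hg
    change F.map (f ≫ g ≫ h) = 0
    simp [hg']

/-- A functor is `I`-exact if it vanishes on the morphisms in `I`. -/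
def IsExact (I : MorphismIdeal T) {C : Type u'} [Category.{v'} C] [Preadditive C]
    (F : T ⥤ C) : Prop :=
  ∀ ⦃A B : T⦄ (f : A ⟶ B), f ∈ I.hom A B → F.map f = 0

/-- An object `A` is `I`-projective if the functor `T(A, -)` to abelian groups is `I`-exact. -/
def IsProjective (I : MorphismIdeal T) (A : T) : Prop :=
  I.IsExact (preadditiveCoyoneda.obj (Opposite.op A))

end Additive

variable {T : Type u} [Category.{v} T] [Preadditive T]
  [HasZeroObject T] [HasShift T ℤ] [∀ n : ℤ, (shiftFunctor T n).Additive] [Pretriangulated T]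

/-- The kernel of a stable homological functor. -/
def kerStable {C : Type u'} [Category.{v'} C] [Abelian C] [StableCategory C]
    (F : StableHomologicalFunctor T C) : MorphismIdeal T :=
  haveI := F.isHomological
  ker F.functor

/-- An ideal is homological if it is the kernel of a stable homological functor to a stable
abelian category. -/
def IsHomological (I : MorphismIdeal.{u, v} T) : Prop :=
  ∃ (D : Type u'') (_ : Category.{v''} D) (_ : Abelian D) (_ : StableCategory D)
    (G : StableHomologicalFunctor T D), kerStable G = I

/-- A morphism `f : A ⟶ B` is `I`-epic if `g ∈ I` in an exact triangle
`A ⟶ B ⟶ X ⟶ Σ A` with maps `f`, `g`, `h` (the triangle is unique up to isomorphism). -/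
def IsEpic (I : MorphismIdeal T) {A B : T} (f : A ⟶ B) : Prop :=
  ∃ (X : T) (g : B ⟶ X) (h : X ⟶ A⟦(1 : ℤ)⟧),
    Triangle.mk f g h ∈ distTriang T ∧ g ∈ I.hom B X

/-- There are enough `I`-projective objects: each object `A` admits an `I`-epic morphism `P ⟶ A`
from an `I`-projective object `P`. -/
def HasEnoughProjectives (I : MorphismIdeal T) : Prop :=
  ∀ A : T, ∃ (P : T) (π : P ⟶ A), I.IsProjective P ∧ I.IsEpic π

end MorphismIdeal

section Universal

variable {T : Type u} [Category.{v} T] [Preadditive T]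
  [HasZeroObject T] [HasShift T ℤ] [∀ n : ℤ, (shiftFunctor T n).Additive] [Pretriangulated T]
  {C : Type u'} [Category.{v'} C] [Abelian C] [StableCategory C]

/-- A factorization `G ≅ Ḡ ∘ F` of a stable homological functor `G` through a stable
homological functor `F`, where `Ḡ` is a stable exact functor; the isomorphism is one of stable
functors, that is, it is compatible with the suspension isomorphisms. -/
structure StableFactorization (F : StableHomologicalFunctor T C)
    {D : Type u''} [Category.{v''} D] [Abelian D] [StableCategory D]
    (G : StableHomologicalFunctor T D) where
  lift : StableExactFunctor C D
  iso : F.functor ⋙ lift.functor ≅ G.functor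
  iso_susp (A : T) :
    iso.hom.app ((susp T).obj A) ≫ G.suspIso.hom.app A =
      lift.functor.map (F.suspIso.hom.app A) ≫ lift.suspIso.hom.app (F.functor.obj A) ≫
        (susp D).map (iso.hom.app A)

/-- `F` is a universal `I`-exact stable homological functor: it is `I`-exact, and every `I`-exact
stable homological functor `G` to a stable abelian category (with objects in `Type w` and
morphisms in `Type z`) factors as `G ≅ Ḡ ∘ F` for a stable exact functor `Ḡ`, which is unique up
to a natural isomorphism (of stable functors, compatible with the factorizations). -/
structure IsUniversalExact (I : MorphismIdeal T) (F : StableHomologicalFunctor T C) : Prop where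
  isExact : I.IsExact F.functor
  exists_factorization (D : Type w) [Category.{z} D] [Abelian D] [StableCategory D]
    (G : StableHomologicalFunctor T D) (hG : I.IsExact G.functor) :
    Nonempty (StableFactorization F G)
  unique (D : Type w) [Category.{z} D] [Abelian D] [StableCategory D]
    (G : StableHomologicalFunctor T D) (hG : I.IsExact G.functor)
    (Φ Ψ : StableFactorization F G) :
    ∃ θ : Φ.lift.functor ≅ Ψ.lift.functor,
      (∀ A : T, θ.hom.app (F.functor.obj A) ≫ Ψ.iso.hom.app A = Φ.iso.hom.app A) ∧
      (∀ X : C, θ.hom.app ((susp C).obj X) ≫ Ψ.lift.suspIso.hom.app X =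
        Φ.lift.suspIso.hom.app X ≫ (susp D).map (θ.hom.app X))

end Universal

namespace CategoryTheory

/-! Both sides of the equivalence reduce to `kerStable F = I` together with `HasRelCovers`: each
object of `C` is a quotient of some `F Q`, where `F Q` is projective and `F` is bijective on
morphisms out of `Q`. Every object of `C` is then the cokernel of `F a` for some `a : Q₁ ⟶ Q₀` in
`T` between such objects.

Given relative covers, an `I`-exact homological functor `G` extends to `C` by sending the object
presented by `a` to the cokernel of `G a`. By `HasRelCovers.preservesRelExact`, `G` keeps exact
every complex in `T` that `F` makes exact; this makes the extension well defined, exact, and equal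
to `G` on the image of `F`. Transformations out of right exact functors on `C` extend uniquely from
the image of `F`, which supplies the suspension isomorphism and uniqueness. Hence
`isUniversalExact_of_hasRelCovers`.

Conversely, if there are enough `I`-projectives, the coherent functors on them form a stable abelian
category, and the restricted Yoneda functor has kernel `I` and relative covers
(`exists_hasRelCovers`). It is therefore universal, so any universal `F` differs from it by an
equivalence and inherits both properties (`IsUniversalExact.hasRelCovers`).

Since idempotents split in `T`, relative covers lift every projective of `C` to a relatively
projective object (`HasRelCovers.projectivesLift`). By `projectivesLift_iff` this lifting is the
pair of conditions on the partial left adjoint: any natural isomorphism of `F ∘ F^⊢` with the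
inclusion already forces the unit to be invertible. -/

lemma exact_mk_iff_up_to_refinements {C : Type u} [Category.{v} C] [Abelian C] {X Y Z : C}
    (f : X ⟶ Y) (g : Y ⟶ Z) (w : f ≫ g = 0) :
    (ShortComplex.mk f g w).Exact ↔ ∀ ⦃A : C⦄ (x : A ⟶ Y) (_ : x ≫ g = 0),
      ∃ (A' : C) (π : A' ⟶ A) (_ : Epi π) (x' : A' ⟶ X), π ≫ x = x' ≫ f :=
  ShortComplex.exact_iff_exact_up_to_refinements _

/-! ### Relatively projective objects, presentations and the extension of a functor -/

namespace Functor

/-- An object `Q` such that `F Q` is projective and `F` is bijective on morphisms out of `Q`. -/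
structure IsRelProjective {T : Type u} [Category.{v} T] {C : Type u'} [Category.{v'} C]
    (F : T ⥤ C) (Q : T) : Prop where
  projective : Projective (F.obj Q)
  bijective (B : T) : Function.Bijective (F.map : (Q ⟶ B) → (F.obj Q ⟶ F.obj B))

/-- Every object of the target is a quotient of `F Q` for a relatively projective object `Q`. -/
def HasRelCovers {T : Type u} [Category.{v} T] {C : Type u'} [Category.{v'} C]
    (F : T ⥤ C) : Prop :=
  ∀ X : C, ∃ (Q : T) (p : F.obj Q ⟶ X), F.IsRelProjective Q ∧ Epi p

lemma IsRelProjective.exists_lift {T : Type u} [Category.{v} T] {C : Type u'} [Category.{v'} C]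
    {F : T ⥤ C} {Q A : T} (hQ : F.IsRelProjective Q) {X : C}
    (f : F.obj A ⟶ X) [Epi f] (g : F.obj Q ⟶ X) : ∃ y : Q ⟶ A, F.map y ≫ f = g := by
  have := hQ.projective
  obtain ⟨y, hy⟩ := (hQ.bijective A).2 (Projective.factorThru g f)
  exact ⟨y, by simp [hy]⟩

lemma IsRelProjective.exists_lift_of_epi {T : Type u} [Category.{v} T]
    {C : Type u'} [Category.{v'} C] {F : T ⥤ C} {Q A B : T} (hQ : F.IsRelProjective Q)
    (f : A ⟶ B) [Epi (F.map f)] (g : Q ⟶ B) : ∃ y : Q ⟶ A, y ≫ f = g := by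
  obtain ⟨y, hy⟩ := hQ.exists_lift (F.map f) (F.map g)
  exact ⟨y, (hQ.bijective B).1 (by simpa using hy)⟩

section Relative

variable {T : Type u} [Category.{v} T] [Preadditive T] {C : Type u'} [Category.{v'} C] [Abelian C]

/-- A functor `G` preserves the complexes whose image under `F` is exact. -/
def PreservesRelExact (F : T ⥤ C) [F.Additive] {D : Type u''} [Category.{v''} D] [Abelian D]
    (G : T ⥤ D) [G.Additive] : Prop :=
  ∀ S : ShortComplex T, (S.map F).Exact → (S.map G).Exact

/-- A presentation of `X` by images of relatively projective objects. -/
structure RelPresentation (F : T ⥤ C) (X : C) where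
  Q₁ : T
  Q₀ : T
  a : Q₁ ⟶ Q₀
  p : F.obj Q₀ ⟶ X
  proj₁ : F.IsRelProjective Q₁
  proj₀ : F.IsRelProjective Q₀
  epi : Epi p
  zero : F.map a ≫ p = 0
  exact : (ShortComplex.mk _ _ zero).Exact

attribute [instance] RelPresentation.epi

omit [Preadditive T] in
lemma IsRelProjective.exists_lift_of_exact {F : T ⥤ C} {Q A B : T} (hQ : F.IsRelProjective Q)
    {Z : C} {f : A ⟶ B} {g : F.obj B ⟶ Z} {w : F.map f ≫ g = 0}
    (h : (ShortComplex.mk _ _ w).Exact)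
    (y : Q ⟶ B) (hy : F.map y ≫ g = 0) : ∃ x : Q ⟶ A, x ≫ f = y := by
  have := hQ.projective
  obtain ⟨x, hx⟩ := (hQ.bijective A).2 (h.liftFromProjective (F.map y) hy)
  refine ⟨x, (hQ.bijective B).1 ?_⟩
  rw [F.map_comp, hx]
  exact h.liftFromProjective_comp _ _

omit [Preadditive T] in
lemma HasRelCovers.exists_cover_exact {F : T ⥤ C} (hF : F.HasRelCovers) {B : T} {Z : C}
    (g : F.obj B ⟶ Z) : ∃ (Q : T) (f : Q ⟶ B) (_ : F.IsRelProjective Q) (w : F.map f ≫ g = 0),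
      (ShortComplex.mk _ _ w).Exact := by
  obtain ⟨Q, q, hQ, hq⟩ := hF (Limits.kernel g)
  obtain ⟨f, hf⟩ := (hQ.bijective B).2 (q ≫ kernel.ι g)
  have w : F.map f ≫ g = 0 := by simp [hf]
  refine ⟨Q, f, hQ, w, ?_⟩
  rw [ShortComplex.exact_iff_exact_up_to_refinements]
  intro A x hx
  obtain ⟨A', π, hπ, y, hy⟩ := surjective_up_to_refinements_of_epi q (kernel.lift g x hx)
  refine ⟨A', π, hπ, y, ?_⟩
  have := hy =≫ kernel.ι g
  simpa [hf] using this

omit [Preadditive T] [Abelian C] in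
lemma HasRelCovers.exists_cover {F : T ⥤ C} (hF : F.HasRelCovers) (A : T) :
    ∃ (Q : T) (f : Q ⟶ A), F.IsRelProjective Q ∧ Epi (F.map f) := by
  obtain ⟨Q, q, hQ, hq⟩ := hF (F.obj A)
  obtain ⟨f, hf⟩ := (hQ.bijective A).2 q
  exact ⟨Q, f, hQ, by rwa [hf]⟩

omit [Preadditive T] in
lemma HasRelCovers.nonempty_presentation {F : T ⥤ C} (hF : F.HasRelCovers) (X : C) :
    Nonempty (F.RelPresentation X) := by
  obtain ⟨Q₀, p, h₀, hp⟩ := hF X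
  obtain ⟨Q₁, a, h₁, w, hw⟩ := hF.exists_cover_exact p
  exact ⟨⟨Q₁, Q₀, a, p, h₁, h₀, hp, w, hw⟩⟩

/-- A chosen presentation. -/
noncomputable def HasRelCovers.presentation {F : T ⥤ C} (hF : F.HasRelCovers) (X : C) :
    F.RelPresentation X := (hF.nonempty_presentation X).some

variable {F : T ⥤ C} [F.Additive] {D : Type u''} [Category.{v''} D] [Abelian D]
  {G : T ⥤ D} [G.Additive]

lemma PreservesRelExact.epi_map (hG : F.PreservesRelExact G) {A B : T} (f : A ⟶ B)
    [Epi (F.map f)] : Epi (G.map f) := by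
  have h := hG (ShortComplex.mk f (0 : B ⟶ B) comp_zero)
    ((ShortComplex.exact_iff_epi _ (F.map_zero _ _)).2 ‹_›)
  exact (ShortComplex.exact_iff_epi _ (G.map_zero _ _)).1 h

/-- `G` turns a relative cover of `A` into an epimorphism, so equalities out of `G A` can be tested
on relatively projective objects. -/
lemma PreservesRelExact.hom_ext (hG : F.PreservesRelExact G) (hF : F.HasRelCovers) {A : T} {W : D}
    {f g : G.obj A ⟶ W}
    (h : ∀ ⦃Q : T⦄ (_ : F.IsRelProjective Q) (z : Q ⟶ A), G.map z ≫ f = G.map z ≫ g) : f = g := by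
  obtain ⟨Q, z, hQ, hz⟩ := hF.exists_cover A
  have := hG.epi_map z
  rw [← cancel_epi (G.map z), h hQ]

omit [Preadditive T] [F.Additive] [G.Additive] in
lemma RelPresentation.map_comp_π {X : C} (P : F.RelPresentation X) {Q : T}
    (hQ : F.IsRelProjective Q) (y : Q ⟶ P.Q₀) (hy : F.map y ≫ P.p = 0) :
    G.map y ≫ cokernel.π (G.map P.a) = 0 := by
  obtain ⟨x, rfl⟩ := hQ.exists_lift_of_exact P.exact y hy
  simp

/-- Cover `A` by `t : Q ⟶ A` and the kernel of `F t` by `b : Q' ⟶ Q`. Then `G A` is the cokernel of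
`G b`, and a lift `y₀` of `F t ≫ x` induces a map on it: `F (b ≫ y₀)` dies in `X`, so `b ≫ y₀`
factors through `P.a`. The same factorization shows independence of all lifts. -/
lemma PreservesRelExact.exists_component (hG : F.PreservesRelExact G) (hF : F.HasRelCovers)
    {X : C} (P : F.RelPresentation X) {A : T} (x : F.obj A ⟶ X) :
    ∃ k : G.obj A ⟶ cokernel (G.map P.a), ∀ ⦃Q : T⦄ (_ : F.IsRelProjective Q) (z : Q ⟶ A)
      (y : Q ⟶ P.Q₀), F.map y ≫ P.p = F.map z ≫ x →
        G.map z ≫ k = G.map y ≫ cokernel.π (G.map P.a) := by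
  obtain ⟨Q, t, hQ, ht⟩ := hF.exists_cover A
  obtain ⟨y₀, hy₀⟩ := hQ.exists_lift P.p (F.map t ≫ x)
  obtain ⟨Q', b, hQ', w, hb⟩ := hF.exists_cover_exact (F.map t)
  have hbt : b ≫ t = 0 := (hQ'.bijective A).1 (by simpa using w)
  have := hG.epi_map t
  have ex : ((ShortComplex.mk _ _ hbt).map G).Exact := hG _ hb
  have : Epi ((ShortComplex.mk _ _ hbt).map G).g := this
  have hz : G.map b ≫ G.map y₀ ≫ cokernel.π (G.map P.a) = 0 := by
    rw [← Category.assoc, ← G.map_comp]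
    apply P.map_comp_π hQ'
    rw [F.map_comp, Category.assoc, hy₀, reassoc_of% w, zero_comp]
  obtain ⟨d, hd⟩ : ∃ d : G.obj A ⟶ cokernel (G.map P.a),
      G.map t ≫ d = G.map y₀ ≫ cokernel.π (G.map P.a) := ⟨ex.desc _ hz, ex.g_desc _ hz⟩
  refine ⟨d, fun R hR z y h ↦ ?_⟩
  obtain ⟨s, rfl⟩ := hR.exists_lift_of_epi t z
  rw [G.map_comp, Category.assoc, hd, ← sub_eq_zero, ← Category.assoc, ← G.map_comp,
    ← Preadditive.sub_comp, ← G.map_sub]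
  apply P.map_comp_π hR
  simp [hy₀, h]

/-- The canonical map from `G A` to the extension of `G` at `X`, for a morphism `F A ⟶ X`. -/
noncomputable def PreservesRelExact.component (hG : F.PreservesRelExact G) (hF : F.HasRelCovers)
    {X : C} {A : T} (x : F.obj A ⟶ X) : G.obj A ⟶ cokernel (G.map (hF.presentation X).a) :=
  (hG.exists_component hF (hF.presentation X) x).choose

section

variable (hG : F.PreservesRelExact G) (hF : F.HasRelCovers)

namespace PreservesRelExact

lemma map_component {X : C} {A : T} (x : F.obj A ⟶ X) {Q : T} (hQ : F.IsRelProjective Q)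
    (z : Q ⟶ A) (y : Q ⟶ (hF.presentation X).Q₀)
    (h : F.map y ≫ (hF.presentation X).p = F.map z ≫ x) :
    G.map z ≫ hG.component hF x = G.map y ≫ cokernel.π (G.map (hF.presentation X).a) :=
  (hG.exists_component hF (hF.presentation X) x).choose_spec hQ z y h

lemma component_p (X : C) : hG.component hF (hF.presentation X).p =
    cokernel.π (G.map (hF.presentation X).a) :=
  hG.hom_ext hF fun _ hQ z ↦ hG.map_component hF _ hQ z z rfl

lemma map_comp_component {X : C} {A B : T} (t : A ⟶ B) (x : F.obj B ⟶ X) :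
    G.map t ≫ hG.component hF x = hG.component hF (F.map t ≫ x) :=
  hG.hom_ext hF fun _ hQ z ↦ by
    obtain ⟨y, hy⟩ := hQ.exists_lift (hF.presentation X).p (F.map z ≫ F.map t ≫ x)
    rw [hG.map_component hF _ hQ z y hy, ← Category.assoc, ← G.map_comp,
      hG.map_component hF _ hQ (z ≫ t) y (by simpa using hy)]

lemma component_add {X : C} {A : T} (x x' : F.obj A ⟶ X) :
    hG.component hF (x + x') = hG.component hF x + hG.component hF x' :=
  hG.hom_ext hF fun _ hQ z ↦ by
    obtain ⟨y, hy⟩ := hQ.exists_lift (hF.presentation X).p (F.map z ≫ x)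
    obtain ⟨y', hy'⟩ := hQ.exists_lift (hF.presentation X).p (F.map z ≫ x')
    rw [Preadditive.comp_add, hG.map_component hF _ hQ z y hy,
      hG.map_component hF _ hQ z y' hy',
      hG.map_component hF _ hQ z (y + y') (by simp [hy, hy']), G.map_add, Preadditive.add_comp]

lemma component_zero {X : C} (A : T) : hG.component hF (0 : F.obj A ⟶ X) = 0 := by
  simpa using hG.component_add hF (0 : F.obj A ⟶ X) 0

/-- The action on morphisms of the extension of `G`. -/
noncomputable def extensionMap {X Y : C} (f : X ⟶ Y) :
    cokernel (G.map (hF.presentation X).a) ⟶ cokernel (G.map (hF.presentation Y).a) :=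
  cokernel.desc _ (hG.component hF ((hF.presentation X).p ≫ f)) (by
    rw [map_comp_component, reassoc_of% (hF.presentation X).zero, zero_comp, component_zero])

lemma component_extensionMap {A : T} {X Y : C} (x : F.obj A ⟶ X) (f : X ⟶ Y) :
    hG.component hF x ≫ hG.extensionMap hF f = hG.component hF (x ≫ f) :=
  hG.hom_ext hF fun _ hQ z ↦ by
    obtain ⟨y, hy⟩ := hQ.exists_lift (hF.presentation X).p (F.map z ≫ x)
    rw [← Category.assoc, hG.map_component hF _ hQ z y hy, Category.assoc, extensionMap,
      cokernel.π_desc, map_comp_component, map_comp_component, reassoc_of% hy]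

/-- The exact extension `C ⥤ D` of `G : T ⥤ D` along `F : T ⥤ C`. -/
noncomputable def extension : C ⥤ D where
  obj X := cokernel (G.map (hF.presentation X).a)
  map f := hG.extensionMap hF f
  map_id X := by
    rw [← cancel_epi (cokernel.π _), ← component_p (hF := hF) (hG := hG), component_extensionMap]
    simp
  map_comp f g := by
    rw [← cancel_epi (cokernel.π _), ← component_p (hF := hF) (hG := hG), ← Category.assoc]
    simp only [component_extensionMap, Category.assoc]

/-- `component` as a morphism to the value of the extension. -/
noncomputable def toExtension {A : T} {X : C} (x : F.obj A ⟶ X) :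
    G.obj A ⟶ (hG.extension hF).obj X :=
  hG.component hF x

lemma toExtension_map {A : T} {X Y : C} (x : F.obj A ⟶ X) (f : X ⟶ Y) :
    hG.toExtension hF x ≫ (hG.extension hF).map f = hG.toExtension hF (x ≫ f) :=
  hG.component_extensionMap hF x f

lemma map_toExtension {X : C} {A B : T} (t : A ⟶ B) (x : F.obj B ⟶ X) :
    G.map t ≫ hG.toExtension hF x = hG.toExtension hF (F.map t ≫ x) :=
  hG.map_comp_component hF t x

lemma toExtension_add {X : C} {A : T} (x x' : F.obj A ⟶ X) :
    hG.toExtension hF (x + x') = hG.toExtension hF x + hG.toExtension hF x' :=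
  hG.component_add hF x x'

lemma toExtension_zero {X : C} (A : T) :
    hG.toExtension hF (0 : F.obj A ⟶ X) = 0 := hG.component_zero hF A

instance epi_toExtension_p (X : C) : Epi (hG.toExtension hF (hF.presentation X).p) := by
  rw [toExtension, component_p]
  exact inferInstanceAs (Epi (cokernel.π _))

lemma toExtension_p_exact (X : C) :
    ∃ w : G.map (hF.presentation X).a ≫ hG.toExtension hF (hF.presentation X).p = 0,
      (ShortComplex.mk _ _ w).Exact := by
  rw [toExtension, component_p]
  exact ⟨cokernel.condition _, ShortComplex.exact_cokernel _⟩

/-- The augmentation of the presentation of `F A` is `F t` for some `t` in `T`, and `P.a ≫ t = 0`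
already in `T`. An element of the kernel, lifted along `G t`, comes from `G P.a` and so vanishes in
`G A`. -/
lemma isIso_toExtension_id (A : T) : IsIso (hG.toExtension hF (𝟙 (F.obj A))) := by
  set P := hF.presentation (F.obj A)
  obtain ⟨t, ht⟩ := (P.proj₀.bijective A).2 P.p
  have hat : P.a ≫ t = 0 := (P.proj₁.bijective A).1 (by simp [ht, P.zero])
  have ht' : Epi (F.map t) := by rw [ht]; infer_instance
  have hGt : Epi (G.map t) := hG.epi_map t
  have hp : G.map t ≫ hG.toExtension hF (𝟙 (F.obj A)) = hG.toExtension hF P.p := by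
    rw [map_toExtension, Category.comp_id, ht]
  have : Epi (hG.toExtension hF (𝟙 (F.obj A))) :=
    have := hG.epi_toExtension_p hF (F.obj A)
    epi_of_epi_fac hp
  have : Mono (hG.toExtension hF (𝟙 (F.obj A))) := by
    rw [Preadditive.mono_iff_cancel_zero]
    intro R x hx
    obtain ⟨R', π, hπ, y, hy⟩ := surjective_up_to_refinements_of_epi (G.map t) x
    obtain ⟨w, ex⟩ := hG.toExtension_p_exact hF (F.obj A)
    obtain ⟨R'', π', hπ', y', hy'⟩ := ex.exact_up_to_refinements y (by
      change y ≫ hG.toExtension hF P.p = 0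
      rw [← hp, ← Category.assoc, ← hy, Category.assoc, hx, comp_zero])
    rw [← cancel_epi π, ← cancel_epi π', hy, ← Category.assoc, hy', Category.assoc]
    dsimp only
    rw [← G.map_comp, hat]
    simp
  exact isIso_of_mono_of_epi _

/-- The extension of `G` along `F` restricts to `G`. -/
noncomputable def extensionIso : F ⋙ hG.extension hF ≅ G :=
  (NatIso.ofComponents (fun A ↦
    have := hG.isIso_toExtension_id hF A
    asIso (hG.toExtension hF (𝟙 (F.obj A)))) (fun f ↦ by
      simp [map_toExtension, toExtension_map])).symm

instance additive_extension : (hG.extension hF).Additive where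
  map_add {X Y f g} := by
    rw [← cancel_epi (hG.toExtension hF (hF.presentation X).p)]
    simp only [toExtension_map, Preadditive.comp_add, toExtension_add]

end PreservesRelExact

end

end Relative
end Functor

end CategoryTheory

/-! ### Exactness of the extension -/

namespace CategoryTheory.Functor

section Exactness

variable {T : Type u} [Category.{v} T] [Preadditive T] {C : Type u'} [Category.{v'} C] [Abelian C]
  {F : T ⥤ C} [F.Additive] {D : Type u''} [Category.{v''} D] [Abelian D]
  {G : T ⥤ D} [G.Additive] (hG : F.PreservesRelExact G) (hF : F.HasRelCovers)

namespace PreservesRelExact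

lemma epi_extension_map {X Y : C} (f : X ⟶ Y) [Epi f] : Epi ((hG.extension hF).map f) := by
  have := (hF.presentation Y).proj₀.projective
  have h : hG.toExtension hF (Projective.factorThru (hF.presentation Y).p f) ≫
      (hG.extension hF).map f = hG.toExtension hF (hF.presentation Y).p := by
    simp [toExtension_map]
  have := hG.epi_toExtension_p hF Y
  exact epi_of_epi_fac h

lemma exists_eq_map_of_comp_eq_zero {X : C} {R : D} (y : R ⟶ G.obj (hF.presentation X).Q₀)
    (hy : y ≫ hG.toExtension hF (hF.presentation X).p = 0) :
    ∃ (R' : D) (π : R' ⟶ R) (_ : Epi π) (x : R' ⟶ G.obj (hF.presentation X).Q₁),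
      π ≫ y = x ≫ G.map (hF.presentation X).a := by
  obtain ⟨w, ex⟩ := hG.toExtension_p_exact hF X
  exact ex.exact_up_to_refinements y hy

/-- With `c` lifting `P.p ≫ g` and `t` lifting `P'.p` to `Y`, split `P.p` as `(P.p - F c ≫ t) + F c
≫ t`. The first summand is killed by `g`, hence lifts to `X`. On the given element the second one
factors through `F P'.a ≫ t`, which is also killed by `g`. -/
lemma exact_map_extension {X Y Z : C} (f : X ⟶ Y) (g : Y ⟶ Z) (w : f ≫ g = 0)
    (hS : (ShortComplex.mk f g w).Exact) [Epi g] :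
    ((ShortComplex.mk f g w).map (hG.extension hF)).Exact := by
  refine (exact_mk_iff_up_to_refinements _ _ _).2 fun R y hy ↦ ?_
  change R ⟶ (hG.extension hF).obj Y at y
  change y ≫ (hG.extension hF).map g = 0 at hy
  set P := hF.presentation Y
  set P' := hF.presentation Z
  obtain ⟨R₁, π₁, _, y₁, hy₁⟩ :=
    surjective_up_to_refinements_of_epi (hG.toExtension hF P.p) y
  obtain ⟨c, hc⟩ := P.proj₀.exists_lift P'.p (P.p ≫ g)
  have := P'.proj₀.projective
  let t := Projective.factorThru P'.p g
  have ht : t ≫ g = P'.p := Projective.factorThru_comp _ _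
  obtain ⟨R₂, π₂, _, x, hx⟩ := hG.exists_eq_map_of_comp_eq_zero hF (y₁ ≫ G.map c) (by
    rw [Category.assoc, map_toExtension, hc, ← toExtension_map, ← Category.assoc, ← hy₁,
      Category.assoc, hy, comp_zero])
  have := P.proj₀.projective
  have := P'.proj₁.projective
  have h₁ : (P.p - F.map c ≫ t) ≫ g = 0 := by simp [ht, hc]
  have h₂ : (F.map P'.a ≫ t) ≫ g = 0 := by simp [ht, P'.zero]
  refine ⟨R₂, π₂ ≫ π₁, inferInstance, π₂ ≫ y₁ ≫ hG.toExtension hF (hS.liftFromProjective _ h₁) +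
    x ≫ hG.toExtension hF (hS.liftFromProjective _ h₂), ?_⟩
  change _ = _ ≫ (hG.extension hF).map f
  rw [Preadditive.add_comp]
  have e₁ : hS.liftFromProjective _ h₁ ≫ f = _ := hS.liftFromProjective_comp _ h₁
  have e₂ : hS.liftFromProjective _ h₂ ≫ f = _ := hS.liftFromProjective_comp _ h₂
  simp only [Category.assoc, toExtension_map]
  rw [e₁, e₂]
  have e : hG.toExtension hF P.p =
      hG.toExtension hF (P.p - F.map c ≫ t) + hG.toExtension hF (F.map c ≫ t) := by
    rw [← toExtension_add, sub_add_cancel]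
  rw [hy₁, e, Preadditive.comp_add, Preadditive.comp_add, ← map_toExtension, ← map_toExtension,
    ← reassoc_of% hx]

/-- Here `G` must preserve exactness at a map that need not become epic under `F`. The lifted
element and the witness that it dies in the extension at `Y` form an element of the kernel of `G d`,
so they come from a cover `Q` of the kernel of `F d`. As `f` is monic, the first component `Q ⟶ Q₀`
already dies in `X`. -/
lemma mono_extension_map [HasBinaryBiproducts T] {X Y : C} (f : X ⟶ Y) [Mono f] :
    Mono ((hG.extension hF).map f) := by
  rw [Preadditive.mono_iff_cancel_zero]
  intro R y hy
  obtain ⟨R₁, π₁, _, y₁, hy₁⟩ :=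
    surjective_up_to_refinements_of_epi (hG.toExtension hF (hF.presentation X).p) y
  obtain ⟨c, hc⟩ := (hF.presentation X).proj₀.exists_lift (hF.presentation Y).p ((hF.presentation X).p ≫ f)
  obtain ⟨R₂, π₂, _, x, hx⟩ := hG.exists_eq_map_of_comp_eq_zero hF (y₁ ≫ G.map c) (by
    rw [Category.assoc, map_toExtension, hc, ← toExtension_map, ← Category.assoc, ← hy₁,
      Category.assoc, hy, comp_zero])
  let d : (hF.presentation X).Q₀ ⊞ (hF.presentation Y).Q₁ ⟶ (hF.presentation Y).Q₀ := biprod.desc c (-(hF.presentation Y).a)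
  obtain ⟨Q, b, hQ, w, hb⟩ := hF.exists_cover_exact (F.map d)
  have hbd : b ≫ d = 0 := (hQ.bijective _).1 (by simpa using w)
  obtain ⟨R₃, π₃, _, v, hv⟩ := (exact_mk_iff_up_to_refinements (G.map b) (G.map d)
    (by rw [← G.map_comp, hbd, G.map_zero])).1 (hG (ShortComplex.mk _ _ hbd) hb)
    (π₂ ≫ y₁ ≫ G.map biprod.inl + x ≫ G.map biprod.inr) (by
      simp only [Preadditive.add_comp, Category.assoc, ← G.map_comp]
      simp only [d, biprod.inl_desc, biprod.inr_desc, G.map_neg, Preadditive.comp_neg, hx]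
      exact add_neg_cancel _)
  have hv₁ : π₃ ≫ π₂ ≫ y₁ = v ≫ G.map (b ≫ biprod.fst) := by
    have := hv =≫ G.map biprod.fst
    simp only [Preadditive.add_comp, Preadditive.comp_add, Category.assoc, ← G.map_comp,
      biprod.inl_fst, biprod.inr_fst, G.map_id, G.map_zero, comp_zero, add_zero,
      Category.comp_id] at this
    exact this
  have hbp : F.map (b ≫ biprod.fst) ≫ (hF.presentation X).p = 0 := by
    rw [← cancel_mono f, Category.assoc, ← hc, zero_comp, ← Category.assoc, ← F.map_comp]
    have : (b ≫ biprod.fst) ≫ c = (b ≫ biprod.snd) ≫ (hF.presentation Y).a := by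
      rw [← sub_eq_zero, ← hbd]
      simp [d, biprod.desc_eq, sub_eq_add_neg]
    rw [this, F.map_comp, Category.assoc, (hF.presentation Y).zero, comp_zero]
  rw [← cancel_epi π₁, ← cancel_epi π₂, ← cancel_epi π₃, hy₁, reassoc_of% hv₁, map_toExtension,
    hbp, toExtension_zero]
  simp

lemma exact_extension [HasBinaryBiproducts T] :
    PreservesFiniteLimits (hG.extension hF) ∧ PreservesFiniteColimits (hG.extension hF) :=
  ((hG.extension hF).exact_tfae.out 0 3).1 fun S hS ↦ by
    have := hS.epi_g
    have := hS.mono_f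
    exact ShortComplex.ShortExact.mk' (hG.exact_map_extension hF S.f S.g S.zero hS.exact)
      (hG.mono_extension_map hF S.f) (hG.epi_extension_map hF S.g)

end PreservesRelExact

end Exactness

/-! ### Transformations determined on the image of `F` -/

section Transformations

variable {T : Type u} [Category.{v} T] {C : Type u'} [Category.{v'} C] [Abelian C]
  {F : T ⥤ C} {D : Type u''} [Category.{v''} D] [Abelian D]
  (hF : F.HasRelCovers) {H H' H'' : C ⥤ D}

namespace HasRelCovers

include hF in
omit [Abelian C] [Abelian D] in
lemma natTrans_ext [H.PreservesEpimorphisms] {β β' : H ⟶ H'}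
    (h : ∀ A : T, β.app (F.obj A) = β'.app (F.obj A)) : β = β' := by
  ext X
  obtain ⟨Q, p, hQ, hp⟩ := hF X
  rw [← cancel_epi (H.map p), β.naturality, β'.naturality, h]

variable [H.PreservesZeroMorphisms] [PreservesFiniteColimits H] [H'.PreservesZeroMorphisms]
  (α : F ⋙ H ⟶ F ⋙ H')

-- Right exactness makes `H X` the cokernel of `H (F P.a)`, so `α` at `P.Q₀` descends to `X`.
-- Compatibility with any `x : F A ⟶ X` is checked after covering `A`, where `x` lifts to `P.Q₀`.
include hF in
lemma exists_natTrans_app (X : C) : ∃ β : H.obj X ⟶ H'.obj X,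
    ∀ (A : T) (x : F.obj A ⟶ X), H.map x ≫ β = α.app A ≫ H'.map x := by
  let P := hF.presentation X
  have hP := P.exact.map_of_epi_of_preservesCokernel H P.epi inferInstance
  have : Epi ((ShortComplex.mk _ _ P.zero).map H).g := inferInstanceAs (Epi (H.map P.p))
  have nat {A B : T} (t : A ⟶ B) :
      H.map (F.map t) ≫ α.app B = α.app A ≫ H'.map (F.map t) := α.naturality t
  have hz : H.map (F.map P.a) ≫ α.app P.Q₀ ≫ H'.map P.p = 0 := by
    rw [reassoc_of% (nat P.a), ← H'.map_comp, P.zero, H'.map_zero, comp_zero]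
  obtain ⟨β, hβ⟩ : ∃ β : H.obj X ⟶ H'.obj X, H.map P.p ≫ β = α.app P.Q₀ ≫ H'.map P.p :=
    ⟨hP.desc _ hz, hP.g_desc _ hz⟩
  refine ⟨β, fun A x ↦ ?_⟩
  obtain ⟨Q, t, hQ, ht⟩ := hF.exists_cover A
  obtain ⟨y, hy⟩ := hQ.exists_lift P.p (F.map t ≫ x)
  rw [← cancel_epi (H.map (F.map t)), ← Category.assoc, ← H.map_comp, ← hy, H.map_comp,
    Category.assoc, hβ, ← Category.assoc, nat, reassoc_of% (nat t), Category.assoc,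
    ← H'.map_comp, ← H'.map_comp, hy]

/-- A transformation defined on the image of `F` extends to a right exact functor. -/
noncomputable def natTrans : H ⟶ H' where
  app X := (hF.exists_natTrans_app α X).choose
  naturality X Y f := by
    obtain ⟨Q, p, hQ, hp⟩ := hF X
    rw [← cancel_epi (H.map p), ← Category.assoc, ← H.map_comp,
      (hF.exists_natTrans_app α Y).choose_spec,
      reassoc_of% ((hF.exists_natTrans_app α X).choose_spec Q p), H'.map_comp]

lemma natTrans_app (A : T) : (hF.natTrans α).app (F.obj A) = α.app A := by
  have h := (hF.exists_natTrans_app α (F.obj A)).choose_spec A (𝟙 _)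
  rw [H.map_id, H'.map_id] at h
  exact (Category.id_comp _).symm.trans (h.trans (Category.comp_id _))

/-- An isomorphism on the image of `F` extends to right exact functors. -/
noncomputable def natIso [PreservesFiniteColimits H']
    (e : F ⋙ H ≅ F ⋙ H') : H ≅ H' where
  hom := hF.natTrans e.hom
  inv := hF.natTrans e.inv
  hom_inv_id := hF.natTrans_ext fun A ↦ by simp [natTrans_app]
  inv_hom_id := hF.natTrans_ext fun A ↦ by simp [natTrans_app]

lemma natIso_hom_app [PreservesFiniteColimits H']
    (e : F ⋙ H ≅ F ⋙ H') (A : T) : (hF.natIso e).hom.app (F.obj A) = e.hom.app A :=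
  hF.natTrans_app e.hom A

end HasRelCovers

end Transformations

end CategoryTheory.Functor

/-! ### Homological functors and containment of kernels -/

namespace CategoryTheory.Functor

variable {T : Type u} [Category.{v} T] [Preadditive T]
  [HasZeroObject T] [HasShift T ℤ] [∀ n : ℤ, (shiftFunctor T n).Additive] [Pretriangulated T]
  {C : Type u'} [Category.{v'} C] [Abelian C] {F : T ⥤ C} [F.IsHomological]
  {D : Type u''} [Category.{v''} D] [Abelian D] {G : T ⥤ D} [G.IsHomological]

lemma map_eq_zero_of_epi {A B X : T} {f : A ⟶ B} {g : B ⟶ X} {h : X ⟶ A⟦(1 : ℤ)⟧}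
    (hT : Triangle.mk f g h ∈ distTriang T) [Epi (F.map f)] : F.map g = 0 := by
  have w : f ≫ g = 0 := comp_distTriang_mor_zero₁₂ _ hT
  rw [← cancel_epi (F.map f), ← F.map_comp, w, F.map_zero, comp_zero]

lemma epi_map_of_distTriang {A B X : T} {f : A ⟶ B} {g : B ⟶ X} {h : X ⟶ A⟦(1 : ℤ)⟧}
    (hT : Triangle.mk f g h ∈ distTriang T) (hg : G.map g = 0) : Epi (G.map f) :=
  (ShortComplex.exact_iff_epi _ hg).1 (G.map_distinguished_exact _ hT)

/-- A homological functor makes `f` epic exactly when it kills the next map of a triangle on `f`, so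
the property passes from `F` to `G`. -/
lemma epi_map_of_ker_le (hk : ∀ ⦃A B : T⦄ (f : A ⟶ B), F.map f = 0 → G.map f = 0)
    {A B : T} (f : A ⟶ B) [Epi (F.map f)] : Epi (G.map f) := by
  obtain ⟨X, g, h, hT⟩ := distinguished_cocone_triangle f
  exact epi_map_of_distTriang hT (hk g (map_eq_zero_of_epi hT))

/-- A homological functor that vanishes on the kernel of `F` preserves `F`-exactness. -/
lemma HasRelCovers.preservesRelExact (hF : F.HasRelCovers)
    (hk : ∀ ⦃A B : T⦄ (f : A ⟶ B), F.map f = 0 → G.map f = 0) : F.PreservesRelExact G := by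
  intro S hS
  -- The fibre `N` of `S.g` gives exactness of `G` at `S.X₂` for the map `i`. A relative cover `q`
  -- of `N` stays epic under `G`, and `q ≫ i` factors through `S.f` because `F` makes `S` exact.
  obtain ⟨N, i, h, hT⟩ := distinguished_cocone_triangle₁ S.g
  have w : i ≫ S.g = 0 := comp_distTriang_mor_zero₁₂ _ hT
  obtain ⟨Q, q, hQ, hq⟩ := hF.exists_cover N
  obtain ⟨t, ht⟩ := hQ.exists_lift_of_exact (w := by rw [← F.map_comp, S.zero, F.map_zero])
    (show (ShortComplex.mk (F.map S.f) (F.map S.g) _).Exact from hS) (q ≫ i)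
    (by rw [← F.map_comp, Category.assoc, w, comp_zero, F.map_zero])
  have := epi_map_of_ker_le hk q
  refine (exact_mk_iff_up_to_refinements _ _ _).2 fun R x hx ↦ ?_
  obtain ⟨R₁, π₁, _, x₁, h₁⟩ := (exact_mk_iff_up_to_refinements (G.map i) (G.map S.g)
    (by rw [← G.map_comp, w, G.map_zero])).1 (G.map_distinguished_exact _ hT) x hx
  obtain ⟨R₂, π₂, _, x₂, h₂⟩ := surjective_up_to_refinements_of_epi (G.map q) x₁
  refine ⟨R₂, π₂ ≫ π₁, inferInstance, x₂ ≫ G.map t, ?_⟩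
  rw [Category.assoc, h₁, reassoc_of% h₂, ← G.map_comp, ← ht, G.map_comp, Category.assoc]

end CategoryTheory.Functor

/-! ### Relative covers imply universality and enough projectives -/

section

variable {T : Type u} [Category.{v} T] [Preadditive T]
  [HasZeroObject T] [HasShift T ℤ] [∀ n : ℤ, (shiftFunctor T n).Additive] [Pretriangulated T]
  {C : Type u'} [Category.{v'} C] [Abelian C] [StableCategory C]

attribute [instance] StableHomologicalFunctor.isHomological StableExactFunctor.preservesFiniteLimits
  StableExactFunctor.preservesFiniteColimits StableCategory.additive

instance {D : Type u''} [Category.{v''} D] [Abelian D] [StableCategory D]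
    (H : StableExactFunctor C D) : H.functor.PreservesZeroMorphisms :=
  Functor.preservesZeroMorphisms_of_preserves_initial_object

lemma MorphismIdeal.mem_kerStable_iff (F : StableHomologicalFunctor T C) {A B : T} (f : A ⟶ B) :
    f ∈ (kerStable F).hom A B ↔ F.functor.map f = 0 := Iff.rfl

/-- The components of the isomorphism `F ⋙ Σ ⋙ H ≅ F ⋙ H ⋙ Σ` induced by `F ⋙ H ≅ G`. -/
noncomputable def StableHomologicalFunctor.suspIsoOfIso (F : StableHomologicalFunctor T C)
    {D : Type u''} [Category.{v''} D] [Abelian D] [StableCategory D]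
    (G : StableHomologicalFunctor T D) {H : C ⥤ D} (e : F.functor ⋙ H ≅ G.functor) :
    F.functor ⋙ susp C ⋙ H ≅ F.functor ⋙ H ⋙ susp D :=
  NatIso.ofComponents (fun A ↦ H.mapIso (F.suspIso.app A).symm ≪≫ e.app ((susp T).obj A) ≪≫
    G.suspIso.app A ≪≫ (susp D).mapIso (e.app A).symm) (fun {A B} f ↦ by
      have h₁ := F.suspIso.inv.naturality f
      have h₂ := e.hom.naturality ((susp T).map f)
      have h₃ := G.suspIso.hom.naturality f
      have h₄ := e.inv.naturality f
      simp only [Functor.comp_map] at h₁ h₂ h₃ h₄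
      simp only [Functor.comp_map, Iso.trans_hom, Functor.mapIso_hom, Iso.symm_hom, Iso.app_inv,
        Iso.app_hom, Category.assoc, ← Functor.map_comp, ← h₄]
      simp only [← Category.assoc, ← Functor.map_comp, h₁]
      simp only [Functor.map_comp, Category.assoc]
      rw [reassoc_of% h₂, reassoc_of% h₃])

/-- The lift is the exact extension. Its suspension isomorphism is forced on the image of `F` and
extends from there; likewise for the comparison of two factorizations and for its compatibility with
suspension. -/
lemma isUniversalExact_of_hasRelCovers (F : StableHomologicalFunctor T C)
    (hF : F.functor.HasRelCovers) :
    IsUniversalExact.{w, z} (MorphismIdeal.kerStable F) F where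
  isExact _ _ _ hf := hf
  exists_factorization D _ _ _ G hG := by
    have hG' := hF.preservesRelExact (G := G.functor) hG
    have hex := hG'.exact_extension hF
    have := hex.1
    have := hex.2
    have : (susp C).Additive := StableCategory.additive
    have : (susp D).Additive := StableCategory.additive
    exact ⟨{
      lift := ⟨hG'.extension hF, hex.1, hex.2,
        hF.natIso (F.suspIsoOfIso G (hG'.extensionIso hF))⟩
      iso := hG'.extensionIso hF
      iso_susp := fun A ↦ by
        dsimp only
        rw [Functor.HasRelCovers.natIso_hom_app]
        simp [StableHomologicalFunctor.suspIsoOfIso, ← Functor.map_comp, ← Functor.map_comp_assoc]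
        }⟩
  unique D _ _ _ G hG Φ Ψ := by
    let θ := hF.natIso (Φ.iso ≪≫ Ψ.iso.symm)
    have hθ (A : T) : θ.hom.app (F.functor.obj A) ≫ Ψ.iso.hom.app A = Φ.iso.hom.app A := by
      simp [θ, Functor.HasRelCovers.natIso_hom_app]
    refine ⟨θ, hθ, fun X ↦ ?_⟩
    have : (susp C ⋙ Φ.lift.functor).PreservesEpimorphisms := inferInstance
    refine NatTrans.congr_app (hF.natTrans_ext
      (β := Functor.whiskerLeft (susp C) θ.hom ≫ Ψ.lift.suspIso.hom)
      (β' := Φ.lift.suspIso.hom ≫ Functor.whiskerRight θ.hom (susp D)) fun A ↦ ?_) X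
    dsimp
    have h₁ := Φ.iso_susp A
    have h₂ := Ψ.iso_susp A
    have h₃ := θ.hom.naturality (F.suspIso.hom.app A)
    dsimp at h₁ h₂ h₃
    -- After cancelling these two isomorphisms, both sides reduce to the compatibility of `Φ` and
    -- `Ψ` with suspension.
    rw [← cancel_epi (Φ.lift.functor.map (F.suspIso.hom.app A)),
      ← cancel_mono ((susp D).map (Ψ.iso.hom.app A))]
    simp only [Category.assoc, ← Functor.map_comp, hθ]
    rw [reassoc_of% h₃, ← h₁, ← h₂, ← hθ, Category.assoc]

namespace MorphismIdeal

lemma isProjective_of_isRelProjective (F : StableHomologicalFunctor T C) {Q : T}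
    (hQ : F.functor.IsRelProjective Q) : (kerStable F).IsProjective Q := by
  intro A B f hf
  rw [mem_kerStable_iff] at hf
  ext (x : Q ⟶ A)
  refine (hQ.bijective B).1 ?_
  change F.functor.map (x ≫ f) = F.functor.map 0
  rw [F.functor.map_comp, hf, comp_zero, F.functor.map_zero]

lemma hasEnoughProjectives_of_hasRelCovers (F : StableHomologicalFunctor T C)
    (hF : F.functor.HasRelCovers) : (kerStable F).HasEnoughProjectives := fun A ↦ by
  obtain ⟨Q, q, hQ, hq⟩ := hF.exists_cover A
  obtain ⟨X, g, h, hT⟩ := distinguished_cocone_triangle q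
  exact ⟨Q, q, isProjective_of_isRelProjective F hQ, X, g, h, hT, Functor.map_eq_zero_of_epi hT⟩

end MorphismIdeal

end

/-! ### Relatively projective objects and the partial left adjoint -/

namespace CategoryTheory.Functor

variable {T : Type u} [Category.{v} T] {C : Type u'} [Category.{v'} C] (F : T ⥤ C)

/-- Every projective object is of the form `F Q` for a relatively projective object `Q`. -/
def ProjectivesLift : Prop :=
  ∀ (P : C) [Projective P], ∃ Q : T, F.IsRelProjective Q ∧ Nonempty (F.obj Q ≅ P)

variable {F}

lemma ProjectivesLift.hasRelCovers [EnoughProjectives C] (h : F.ProjectivesLift) :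
    F.HasRelCovers := fun X ↦ by
  obtain ⟨Q, hQ, ⟨e⟩⟩ := h (Projective.over X)
  exact ⟨Q, e.hom ≫ Projective.π X, hQ, inferInstance⟩

lemma IsRelProjective.corepresentableBy {Q : T} (hQ : F.IsRelProjective Q) {P : C}
    (e : F.obj Q ≅ P) : (F ⋙ coyoneda.obj (Opposite.op P)).IsCorepresentable := by
  refine ⟨Q, ⟨⟨fun {B} ↦ (Equiv.ofBijective _ (hQ.bijective B)).trans
    ⟨fun f ↦ e.inv ≫ f, fun f ↦ e.hom ≫ f, fun f ↦ by simp, fun f ↦ by simp⟩, ?_⟩⟩⟩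
  intro Y Y' g f
  simp

/-- The unit of the partial left adjoint. -/
noncomputable def partialLeftAdjointUnit (X : F.PartialLeftAdjointSource) :
    X.obj ⟶ F.obj (F.partialLeftAdjointObj X) :=
  F.partialLeftAdjointHomEquiv (𝟙 _)

lemma partialLeftAdjointUnit_comp_map (X : F.PartialLeftAdjointSource) {Y : T}
    (f : F.partialLeftAdjointObj X ⟶ Y) :
    partialLeftAdjointUnit X ≫ F.map f = F.partialLeftAdjointHomEquiv f := by
  rw [partialLeftAdjointUnit, ← partialLeftAdjointHomEquiv_comp, Category.id_comp]

lemma partialLeftAdjointUnit_naturality {X Y : F.PartialLeftAdjointSource} (f : X ⟶ Y) :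
    partialLeftAdjointUnit X ≫ F.map (F.partialLeftAdjointMap f) =
      f.hom ≫ partialLeftAdjointUnit Y := by
  rw [partialLeftAdjointUnit_comp_map]
  exact F.partialLeftAdjointHomEquiv_map f

/-- The adjunction bijection is `f ↦ unit ≫ F f`; an invertible unit can be cancelled, leaving
`F.map` bijective. -/
lemma isRelProjective_of_isIso_unit (X : F.PartialLeftAdjointSource) [Projective X.obj]
    [IsIso (partialLeftAdjointUnit X)] : F.IsRelProjective (F.partialLeftAdjointObj X) where
  projective := Projective.of_iso (asIso (partialLeftAdjointUnit X)) ‹_›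
  bijective B := by
    have h : (fun f : F.partialLeftAdjointObj X ⟶ B ↦ partialLeftAdjointUnit X ≫ F.map f) =
        F.partialLeftAdjointHomEquiv := funext fun f ↦ partialLeftAdjointUnit_comp_map X f
    have hb : Function.Bijective
        (fun f : F.partialLeftAdjointObj X ⟶ B ↦ partialLeftAdjointUnit X ≫ F.map f) :=
      h ▸ F.partialLeftAdjointHomEquiv.bijective
    refine ⟨fun f g hfg ↦ hb.1 (by simp only [hfg]), fun g ↦ ?_⟩
    obtain ⟨f, hf⟩ := hb.2 (partialLeftAdjointUnit X ≫ g)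
    exact ⟨f, (cancel_epi _).1 hf⟩

lemma isIso_unit_of_isRelProjective (X : F.PartialLeftAdjointSource) {Q : T}
    (hQ : F.IsRelProjective Q) (e : F.obj Q ≅ X.obj) : IsIso (partialLeftAdjointUnit X) := by
  let f : F.partialLeftAdjointObj X ⟶ Q := F.partialLeftAdjointHomEquiv.symm e.inv
  have hf : partialLeftAdjointUnit X ≫ F.map f = e.inv := by
    rw [partialLeftAdjointUnit_comp_map, Equiv.apply_symm_apply]
  obtain ⟨g, hg⟩ := (hQ.bijective _).2 (e.hom ≫ partialLeftAdjointUnit X)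
  have hfg : f ≫ g = 𝟙 _ := by
    apply F.partialLeftAdjointHomEquiv.injective
    rw [← partialLeftAdjointUnit_comp_map, F.map_comp, reassoc_of% hf, hg,
      Iso.inv_hom_id_assoc]
    rfl
  refine ⟨F.map f ≫ e.hom, by rw [reassoc_of% hf, Iso.inv_hom_id], ?_⟩
  rw [Category.assoc, ← hg, ← F.map_comp, hfg, F.map_id]

/-- In the reverse direction the given isomorphism `α` is arbitrary, not assumed to be inverse to
the unit. Composing the two gives a natural endomorphism `e` of the inclusion of the projectives. A
triangle identity gives `e` a one-sided inverse at `F F^⊢ P`, hence at `P`, and naturality of `e`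
makes it two-sided. -/
lemma projectivesLift_iff : F.ProjectivesLift ↔
    ∃ h : isProjective C ≤ F.leftAdjointObjIsDefined,
      Nonempty (ObjectProperty.ιOfLE h ⋙ F.partialLeftAdjoint ⋙ F ≅ (isProjective C).ι) := by
  constructor
  · intro hF
    have h : isProjective C ≤ F.leftAdjointObjIsDefined := fun P (hP : Projective P) ↦ by
      obtain ⟨Q, hQ, ⟨e⟩⟩ := hF P
      exact hQ.corepresentableBy e
    have hu (P : (isProjective C).FullSubcategory) :
        IsIso (partialLeftAdjointUnit ((ObjectProperty.ιOfLE h).obj P)) := by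
      have : Projective P.obj := P.property
      obtain ⟨Q, hQ, ⟨e⟩⟩ := hF P.obj
      exact isIso_unit_of_isRelProjective _ hQ e
    exact ⟨h, ⟨(NatIso.ofComponents (fun P ↦
      @asIso _ _ _ _ (partialLeftAdjointUnit ((ObjectProperty.ιOfLE h).obj P)) (hu P)) (fun {P P'} f ↦
        (partialLeftAdjointUnit_naturality ((ObjectProperty.ιOfLE h).map f)).symm)).symm⟩⟩
  · rintro ⟨h, ⟨α⟩⟩ P hP
    let L := ObjectProperty.ιOfLE h
    let P' : (isProjective C).FullSubcategory := ⟨P, hP⟩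
    -- the natural endomorphism of the identity given by the unit
    let e (R : (isProjective C).FullSubcategory) : R.obj ⟶ R.obj :=
      partialLeftAdjointUnit (L.obj R) ≫ α.hom.app R
    have he {R R' : (isProjective C).FullSubcategory} (f : R ⟶ R') :
        e R ≫ f.hom = f.hom ≫ e R' := by
      have h₁ : F.map (F.partialLeftAdjointMap (L.map f)) ≫ α.hom.app R' =
        α.hom.app R ≫ f.hom := α.hom.naturality f
      have h₂ : partialLeftAdjointUnit (L.obj R) ≫ F.map (F.partialLeftAdjointMap (L.map f)) =
        f.hom ≫ partialLeftAdjointUnit (L.obj R') := partialLeftAdjointUnit_naturality (L.map f)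
      exact (Category.assoc _ _ _).trans ((congrArg _ h₁.symm).trans
        ((Category.assoc _ _ _).symm.trans ((congrArg (· ≫ _) h₂).trans (Category.assoc _ _ _))))
    let a : F.obj (F.partialLeftAdjointObj (L.obj P')) ≅ P := α.app P'
    let M : (isProjective C).FullSubcategory :=
      ⟨F.obj (F.partialLeftAdjointObj (L.obj P')), Projective.of_iso a.symm hP⟩
    -- The counit `F^⊢ F ⟶ id` at `F^⊢ P`, mapped by `F` and corrected by `α`.
    let s : M.obj ⟶ M.obj := α.inv.app M ≫ F.map (F.partialLeftAdjointHomEquiv.symm (𝟙 M.obj))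
    have hs : e M ≫ s = 𝟙 _ := by
      have h₁ : α.hom.app M ≫ α.inv.app M = 𝟙 (F.obj (F.partialLeftAdjointObj (L.obj M))) :=
        α.hom_inv_id_app M
      have h₂ : partialLeftAdjointUnit (L.obj M) ≫
          F.map (F.partialLeftAdjointHomEquiv.symm (𝟙 M.obj)) = 𝟙 M.obj := by
        rw [partialLeftAdjointUnit_comp_map, Equiv.apply_symm_apply]
      refine Eq.trans ?_ h₂
      exact (Category.assoc _ _ _).trans (congrArg _ ((Category.assoc _ _ _).symm.trans
        ((congrArg (· ≫ _) h₁).trans (Category.id_comp _))))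
    have h₁ : e M ≫ a.hom = a.hom ≫ e P' := he (R := M) (R' := P') (ObjectProperty.homMk a.hom)
    let r : P ⟶ P := a.inv ≫ s ≫ a.hom
    have h₂ : e P' ≫ r = 𝟙 P := by
      rw [← cancel_epi a.hom, ← reassoc_of% h₁]
      simp [r, reassoc_of% hs]
    -- As a natural endomorphism, `e` commutes with `r`.
    have h₃ : r ≫ e P' = 𝟙 P :=
      (he (R := P') (R' := P') (ObjectProperty.homMk r)).symm.trans h₂
    have : IsIso (e P') := ⟨r, h₂, h₃⟩
    have hu : partialLeftAdjointUnit (L.obj P') = e P' ≫ a.inv :=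
      ((Category.assoc _ _ _).trans ((congrArg _ a.hom_inv_id).trans (Category.comp_id _))).symm
    have hP' : Projective (L.obj P').obj := hP
    have : IsIso (partialLeftAdjointUnit (L.obj P')) := by rw [hu]; infer_instance
    exact ⟨_, isRelProjective_of_isIso_unit (L.obj P'), ⟨a⟩⟩

end CategoryTheory.Functor

/-! ### Coherent objects in an abelian category -/

namespace CategoryTheory.ObjectProperty

variable {A : Type u} [Category.{v} A] [Abelian A] (W : ObjectProperty A)

/-- An object `X` is coherent with respect to a class `W` if it is a quotient of an object in `W`
and the kernel of every morphism from an object in `W` to `X` is such a quotient as well. -/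
def IsCoherent : ObjectProperty A := fun X ↦
  (∃ (P : A) (p : P ⟶ X), W P ∧ Epi p) ∧
    ∀ ⦃P : A⦄ (f : P ⟶ X), W P → ∃ (Q : A) (q : Q ⟶ P) (w : q ≫ f = 0),
      W Q ∧ (ShortComplex.mk q f w).Exact

/-- Objects of `W` have the lifting property with respect to quotients of objects in `W`. -/
def IsRelativelyProjective : Prop :=
  ∀ ⦃P P' Z : A⦄ (c : P' ⟶ Z) [Epi c] (g : P ⟶ Z), W P → W P' → ∃ l : P ⟶ P', l ≫ c = g

variable {W}

lemma IsRelativelyProjective.exists_lift (hW : W.IsRelativelyProjective) {P Y Z : A}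
    (hP : W P) (hY : W.IsCoherent Y) (c : Y ⟶ Z) [Epi c] (g : P ⟶ Z) :
    ∃ l : P ⟶ Y, l ≫ c = g := by
  obtain ⟨P', p, hP', hp⟩ := hY.1
  obtain ⟨l, hl⟩ := hW (p ≫ c) g hP hP'
  exact ⟨l ≫ p, by rwa [Category.assoc]⟩

/-- If `p` covers `X`, a cover of the kernel of `p ≫ f` maps onto the kernel `K` of `f`. For the
second condition, `g` and `g ≫ k` have the same kernel. -/
lemma isCoherent_of_exact_of_mono {K X Y : A} (k : K ⟶ X) (f : X ⟶ Y) (w : k ≫ f = 0)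
    (h : (ShortComplex.mk k f w).Exact) [Mono k] (hX : W.IsCoherent X) (hY : W.IsCoherent Y) :
    W.IsCoherent K := by
  have h' := (exact_mk_iff_up_to_refinements _ _ _).1 h
  refine ⟨?_, fun P g hP ↦ ?_⟩
  · obtain ⟨P, p, hP, hp⟩ := hX.1
    obtain ⟨Q, q, wq, hQ, ex⟩ := hY.2 (p ≫ f) hP
    have ex' := (exact_mk_iff_up_to_refinements _ _ _).1 ex
    have hk : (q ≫ p) ≫ f = 0 := by simpa using wq
    let t : Q ⟶ K := h.lift (q ≫ p) hk
    have ht : t ≫ k = q ≫ p := h.lift_f (q ≫ p) hk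
    refine ⟨Q, t, hQ, (epi_iff_surjective_up_to_refinements _).2 fun B y ↦ ?_⟩
    obtain ⟨B₁, π₁, _, y₁, h₁⟩ := surjective_up_to_refinements_of_epi p (y ≫ k)
    obtain ⟨B₂, π₂, _, y₂, h₂⟩ := ex' y₁ (by
      rw [← Category.assoc, ← h₁, Category.assoc, Category.assoc, w, comp_zero, comp_zero])
    refine ⟨B₂, π₂ ≫ π₁, inferInstance, y₂, ?_⟩
    rw [← cancel_mono k, Category.assoc, Category.assoc, Category.assoc, h₁, ht,
      reassoc_of% h₂]
  · obtain ⟨Q, q, wq, hQ, ex⟩ := hX.2 (g ≫ k) hP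
    have ex' := (exact_mk_iff_up_to_refinements _ _ _).1 ex
    refine ⟨Q, q, by rw [← cancel_mono k, Category.assoc, wq, zero_comp], hQ,
      (exact_mk_iff_up_to_refinements _ _ _).2 fun B x hx ↦ ex' x (by
        rw [reassoc_of% hx, zero_comp])⟩

lemma isCoherent_of_iso {X Y : A} (e : X ≅ Y) (hX : W.IsCoherent X) : W.IsCoherent Y :=
  isCoherent_of_exact_of_mono e.inv (0 : X ⟶ X) comp_zero
    ((ShortComplex.exact_iff_epi _ rfl).2 (inferInstanceAs (Epi e.inv))) hX hX

instance : W.IsCoherent.IsClosedUnderIsomorphisms where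
  of_iso e h := isCoherent_of_iso e h

instance : W.IsCoherent.IsClosedUnderKernels where
  kernels_le := by
    intro _ ⟨f, k, hk, hf⟩
    have : Mono k.ι := Fork.IsLimit.mono hk
    exact isCoherent_of_exact_of_mono k.ι f k.condition
      (ShortComplex.exact_of_f_is_kernel (ShortComplex.mk k.ι f k.condition)
        (IsLimit.ofIsoLimit hk (Fork.ext (Iso.refl _) (by simp)))) hf.1 hf.2

/-- The kernel of a map into `X ⊞ Y` is found in two stages: cover the kernel of the first
component, then the kernel of the second component restricted to that cover. -/
lemma isCoherent_biprod (hW : ∀ ⦃P Q : A⦄, W P → W Q → W (P ⊞ Q)) {X Y : A}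
    (hX : W.IsCoherent X) (hY : W.IsCoherent Y) : W.IsCoherent (X ⊞ Y) := by
  refine ⟨?_, fun P g hP ↦ ?_⟩
  · obtain ⟨P, p, hP, hp⟩ := hX.1
    obtain ⟨Q, q, hQ, hq⟩ := hY.1
    exact ⟨P ⊞ Q, biprod.map p q, hW hP hQ, inferInstance⟩
  · obtain ⟨Q₁, q₁, w₁, hQ₁, ex₁⟩ := hX.2 (g ≫ biprod.fst) hP
    obtain ⟨Q₂, q₂, w₂, hQ₂, ex₂⟩ := hY.2 (q₁ ≫ g ≫ biprod.snd) hQ₁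
    refine ⟨Q₂, q₂ ≫ q₁, ?_, hQ₂, (exact_mk_iff_up_to_refinements _ _ _).2 fun B x hx ↦ ?_⟩
    · ext
      · simp [w₁]
      · simpa using w₂
    · obtain ⟨B₁, π₁, _, x₁, h₁⟩ := (exact_mk_iff_up_to_refinements _ _ _).1 ex₁ x
        (by rw [reassoc_of% hx, zero_comp])
      obtain ⟨B₂, π₂, _, x₂, h₂⟩ := (exact_mk_iff_up_to_refinements _ _ _).1 ex₂ x₁
        (by rw [← reassoc_of% h₁, reassoc_of% hx, zero_comp, comp_zero])
      exact ⟨B₂, π₂ ≫ π₁, inferInstance, x₂, by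
        rw [Category.assoc, h₁, reassoc_of% h₂]⟩

/-- Lift `g` to `l : P ⟶ Y` and cover `X` by `r : R ⟶ X`. The kernel of `g` consists of those
elements of `P` that `l` sends into the image of `r ≫ f`, so the kernel of `P ⊞ R ⟶ Y` covers it. -/
lemma isCoherent_of_exact_of_epi (hW : ∀ ⦃P Q : A⦄, W P → W Q → W (P ⊞ Q))
    (hW' : W.IsRelativelyProjective) {X Y Z : A} (f : X ⟶ Y) (c : Y ⟶ Z) (w : f ≫ c = 0)
    (h : (ShortComplex.mk f c w).Exact) [Epi c] (hX : W.IsCoherent X) (hY : W.IsCoherent Y) :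
    W.IsCoherent Z := by
  have h' := (exact_mk_iff_up_to_refinements _ _ _).1 h
  refine ⟨?_, fun P g hP ↦ ?_⟩
  · obtain ⟨P, p, hP, hp⟩ := hY.1
    exact ⟨P, p ≫ c, hP, inferInstance⟩
  · obtain ⟨R, r, hR, hr⟩ := hX.1
    obtain ⟨l, hl⟩ := hW'.exists_lift hP hY c g
    obtain ⟨Q, q, wq, hQ, ex⟩ := hY.2 (biprod.desc l (r ≫ f)) (hW hP hR)
    have wq' : q ≫ biprod.fst ≫ l + q ≫ biprod.snd ≫ r ≫ f = 0 := by
      rw [← wq, biprod.desc_eq]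
      simp
    refine ⟨Q, q ≫ biprod.fst, ?_, hQ, (exact_mk_iff_up_to_refinements _ _ _).2 fun B x hx ↦ ?_⟩
    · have := wq' =≫ c
      simp only [Preadditive.add_comp, Category.assoc, w, comp_zero, add_zero, zero_comp, hl] at this
      simpa using this
    · obtain ⟨B₁, π₁, _, y, h₁⟩ := h' (x ≫ l) (by rw [Category.assoc, hl, hx])
      obtain ⟨B₂, π₂, _, z, h₂⟩ := surjective_up_to_refinements_of_epi r y
      obtain ⟨B₃, π₃, _, s, h₃⟩ := (exact_mk_iff_up_to_refinements _ _ _).1 ex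
        (biprod.lift (π₂ ≫ π₁ ≫ x) (-z)) (by
          rw [biprod.lift_desc, Preadditive.neg_comp, ← reassoc_of% h₂, ← h₁]
          simp)
      refine ⟨B₃, π₃ ≫ π₂ ≫ π₁, inferInstance, s, ?_⟩
      have := h₃ =≫ biprod.fst
      simpa using this

lemma isClosedUnderCokernels_isCoherent (hW : ∀ ⦃P Q : A⦄, W P → W Q → W (P ⊞ Q))
    (hW' : W.IsRelativelyProjective) : W.IsCoherent.IsClosedUnderCokernels where
  cokernels_le := by
    intro _ ⟨f, k, hk, hf⟩
    have : Epi k.π := Cofork.IsColimit.epi hk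
    exact isCoherent_of_exact_of_epi hW hW' f k.π k.condition
      (ShortComplex.exact_of_g_is_cokernel (ShortComplex.mk f k.π k.condition)
        (IsColimit.ofIsoColimit hk (Cofork.ext (Iso.refl _) (by simp)))) hf.1 hf.2

lemma containsZero_isCoherent {Z : A} (hZ : IsZero Z) (hW : W Z) :
    W.IsCoherent.ContainsZero where
  exists_zero := ⟨Z, hZ, ⟨Z, 𝟙 Z, hW, inferInstance⟩, fun P _ hP ↦
    ⟨P, 𝟙 P, hZ.eq_of_tgt _ _, hP,
      (ShortComplex.exact_iff_epi _ (hZ.eq_of_tgt _ _)).2 (inferInstanceAs (Epi (𝟙 P)))⟩⟩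

lemma isClosedUnderFiniteProducts_isCoherent {Z : A} (hZ : IsZero Z) (hZW : W Z)
    (hW : ∀ ⦃P Q : A⦄, W P → W Q → W (P ⊞ Q)) : W.IsCoherent.IsClosedUnderFiniteProducts :=
  have := containsZero_isCoherent hZ hZW
  have : W.IsCoherent.IsClosedUnderBinaryProducts := by
    refine ⟨fun X ⟨p⟩ ↦ ?_⟩
    exact isCoherent_of_iso (IsLimit.conePointsIsoOfNatIso (BinaryBiproduct.isLimit _ _) p.isLimit
      (diagramIsoPair p.diag).symm) (isCoherent_biprod hW (p.prop_diag_obj _) (p.prop_diag_obj _))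
  .mk'

end CategoryTheory.ObjectProperty

/-! ### Coherent functors on a full subcategory of `T` -/

namespace CategoryTheory

lemma ShortComplex.exact_iff_evaluation {J : Type u} [Category.{v} J] {A : Type u'}
    [Category.{v'} A] [Abelian A] (S : ShortComplex (J ⥤ A)) :
    S.Exact ↔ ∀ j : J, (S.map ((evaluation J A).obj j)).Exact := by
  simp only [ShortComplex.exact_iff_isZero_homology, Functor.isZero_iff]
  exact forall_congr' fun j ↦ (S.mapHomologyIso ((evaluation J A).obj j)).symm.isZero_iff

namespace ObjectProperty

section RestrictedYoneda

variable {T : Type u} [Category.{v} T] [Preadditive T] (R : ObjectProperty T)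

/-- The Yoneda functor restricted to a full subcategory. -/
def restrictedYoneda : T ⥤ R.FullSubcategoryᵒᵖ ⥤ AddCommGrpCat.{v} where
  obj B :=
    { obj P := AddCommGrpCat.of (P.unop.obj ⟶ B)
      map f := AddCommGrpCat.ofHom (Preadditive.leftComp B f.unop.hom)
      map_id P := by ext (x : P.unop.obj ⟶ B); exact Category.id_comp x
      map_comp f g := by ext (x : _ ⟶ B); exact Category.assoc _ _ x }
  map g :=
    { app P := AddCommGrpCat.ofHom (Preadditive.rightComp P.unop.obj g)
      naturality P P' f := by ext (x : _ ⟶ _); exact Category.assoc f.unop.hom x g }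
  map_id B := by ext P (x : P.unop.obj ⟶ B); exact Category.comp_id x
  map_comp f g := by ext P (x : P.unop.obj ⟶ _); exact (Category.assoc x f g).symm

instance : R.restrictedYoneda.Additive where
  map_add {X Y f g} := by ext P (x : P.unop.obj ⟶ _); exact Preadditive.comp_add _ _ _ x f g

lemma restrictedYoneda_exact_iff (S : ShortComplex T) : (S.map R.restrictedYoneda).Exact ↔
    ∀ ⦃P : T⦄ (_ : R P) (x : P ⟶ S.X₂), x ≫ S.g = 0 → ∃ y : P ⟶ S.X₁, y ≫ S.f = x := by
  rw [ShortComplex.exact_iff_evaluation]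
  constructor
  · intro h P hP
    exact (ShortComplex.ab_exact_iff _).1 (h (.op ⟨P, hP⟩))
  · intro h P
    exact (ShortComplex.ab_exact_iff _).2 (h P.unop.property)

lemma restrictedYoneda_epi_iff {A B : T} (f : A ⟶ B) : Epi (R.restrictedYoneda.map f) ↔
    ∀ ⦃P : T⦄ (_ : R P) (x : P ⟶ B), ∃ y : P ⟶ A, y ≫ f = x := by
  rw [NatTrans.epi_iff_epi_app]
  constructor
  · intro h P hP
    exact (AddCommGrpCat.epi_iff_surjective _).1 (h (.op ⟨P, hP⟩))
  · intro h P
    exact (AddCommGrpCat.epi_iff_surjective _).2 (h P.unop.property)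

lemma restrictedYoneda_map_eq_zero_iff {A B : T} (f : A ⟶ B) : R.restrictedYoneda.map f = 0 ↔
    ∀ ⦃P : T⦄ (_ : R P) (x : P ⟶ A), x ≫ f = 0 := by
  constructor
  · intro h P hP x
    exact ConcreteCategory.congr_hom (NatTrans.congr_app h (.op ⟨P, hP⟩)) x
  · intro h
    ext P (x : P.unop.obj ⟶ A)
    exact h P.unop.property x

lemma restrictedYoneda_hom_ext {Q : T} (hQ : R Q) {M : R.FullSubcategoryᵒᵖ ⥤ AddCommGrpCat.{v}}
    {f g : R.restrictedYoneda.obj Q ⟶ M}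
    (h : f.app (.op ⟨Q, hQ⟩) (𝟙 Q) = g.app (.op ⟨Q, hQ⟩) (𝟙 Q)) : f = g := by
  have key (f : R.restrictedYoneda.obj Q ⟶ M) (P : R.FullSubcategoryᵒᵖ)
      (x : P.unop.obj ⟶ Q) : f.app P x = M.map (.op (homMk x)) (f.app (.op ⟨Q, hQ⟩) (𝟙 Q)) := by
    have := ConcreteCategory.congr_hom
      (f.naturality (X := .op ⟨Q, hQ⟩) (Y := P) (.op (homMk x))) (𝟙 Q)
    refine Eq.trans ?_ this
    exact congrArg (f.app P) (Category.comp_id x).symm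
  ext P x
  exact (key f P x).trans ((congrArg _ h).trans (key g P x).symm)

lemma restrictedYoneda_map_bijective {Q : T} (hQ : R Q) (B : T) : Function.Bijective
    (R.restrictedYoneda.map : (Q ⟶ B) → (R.restrictedYoneda.obj Q ⟶ R.restrictedYoneda.obj B)) := by
  have key (f : Q ⟶ B) : (R.restrictedYoneda.map f).app (.op ⟨Q, hQ⟩) (𝟙 Q) = f :=
    Category.id_comp f
  refine ⟨fun f g h ↦ ?_, fun φ ↦ ⟨φ.app (.op ⟨Q, hQ⟩) (𝟙 Q), ?_⟩⟩
  · rw [← key f, ← key g, h]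
  · exact R.restrictedYoneda_hom_ext hQ (key _)

/-- The objects isomorphic to the image of an object of `R` under the restricted Yoneda functor. -/
def representables : ObjectProperty (R.FullSubcategoryᵒᵖ ⥤ AddCommGrpCat.{v}) := fun X ↦
  ∃ Q : T, R Q ∧ Nonempty (R.restrictedYoneda.obj Q ≅ X)

lemma representables_obj {Q : T} (hQ : R Q) : R.representables (R.restrictedYoneda.obj Q) :=
  ⟨Q, hQ, ⟨Iso.refl _⟩⟩

/-- Epimorphisms of functors are objectwise surjective, so by Yoneda it suffices to lift one element
at `Q`. -/
lemma isRelativelyProjective_representables : R.representables.IsRelativelyProjective := by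
  rintro P P' Z c hc g ⟨Q, hQ, ⟨e⟩⟩ ⟨Q', hQ', ⟨e'⟩⟩
  rw [NatTrans.epi_iff_epi_app] at hc
  have hc' : Epi ((e'.hom ≫ c).app (.op ⟨Q, hQ⟩)) := by
    rw [NatTrans.comp_app]
    infer_instance
  obtain ⟨y, hy⟩ : ∃ y : Q ⟶ Q', (e'.hom ≫ c).app (.op ⟨Q, hQ⟩) y =
      (e.hom ≫ g).app (.op ⟨Q, hQ⟩) (𝟙 Q) := (AddCommGrpCat.epi_iff_surjective _).1 hc' _
  refine ⟨e.inv ≫ R.restrictedYoneda.map y ≫ e'.hom, ?_⟩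
  rw [← cancel_epi e.hom]
  apply R.restrictedYoneda_hom_ext hQ
  refine Eq.trans ?_ hy
  rw [Category.assoc, Category.assoc, Iso.hom_inv_id_assoc]
  exact congrArg ((e'.hom ≫ c).app (.op ⟨Q, hQ⟩)) (Category.id_comp y)

lemma representables_biprod [HasBinaryBiproducts T] (hR : ∀ ⦃P Q : T⦄, R P → R Q → R (P ⊞ Q))
    ⦃X Y : R.FullSubcategoryᵒᵖ ⥤ AddCommGrpCat.{v}⦄ (hX : R.representables X)
    (hY : R.representables Y) : R.representables (X ⊞ Y) := by
  obtain ⟨P, hP, ⟨e⟩⟩ := hX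
  obtain ⟨Q, hQ, ⟨e'⟩⟩ := hY
  have := preservesBinaryBiproducts_of_preservesBiproducts R.restrictedYoneda
  exact ⟨P ⊞ Q, hR hP hQ, ⟨R.restrictedYoneda.mapBiprod P Q ≪≫ biprod.mapIso e e'⟩⟩

/-- The category of coherent functors on `R`. -/
abbrev Coherent := R.representables.IsCoherent.FullSubcategory

/-- A morphism out of a quotient of a representable functor is determined by one element of the
target at the representing object. This bounds the morphism sets even though `R` may be large. -/
instance : LocallySmall.{v} R.Coherent where
  hom_small X Y := by
    obtain ⟨⟨P, p, ⟨Q, hQ, ⟨e⟩⟩, hp⟩, -⟩ := X.property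
    refine small_of_injective (β := Y.obj.obj (.op ⟨Q, hQ⟩))
      (f := fun f ↦ (e.hom ≫ p ≫ f.hom).app (.op ⟨Q, hQ⟩) (𝟙 Q)) fun f g hfg ↦ ?_
    have := R.restrictedYoneda_hom_ext hQ hfg
    rw [cancel_epi, cancel_epi] at this
    exact ObjectProperty.hom_ext _ this

end RestrictedYoneda

section Pretriangulated

variable {T : Type u} [Category.{v} T] [Preadditive T]
  [HasZeroObject T] [HasShift T ℤ] [∀ n : ℤ, (shiftFunctor T n).Additive] [Pretriangulated T]
  (R : ObjectProperty T)

instance : R.restrictedYoneda.IsHomological where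
  exact S hS := by
    refine (R.restrictedYoneda_exact_iff _).2 fun P _ x hx ↦ ?_
    obtain ⟨y, hy⟩ := S.coyoneda_exact₂ hS x hx
    exact ⟨y, hy.symm⟩

/-- Every object is covered by an object of `R`, as seen from objects of `R`. -/
def HasCovers : Prop :=
  ∀ A : T, ∃ (Q : T) (q : Q ⟶ A), R Q ∧ ∀ ⦃P : T⦄ (_ : R P) (x : P ⟶ A), ∃ y : P ⟶ Q, y ≫ q = x

variable {R} (hR : R.HasCovers)

-- A map from a representable functor comes from some `g` in `T`. The fibre of `g` is a weak kernel,
-- and covering it by an object of `R` gives a representable cover of the kernel.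
include hR in
lemma HasCovers.isCoherent_obj (B : T) :
    R.representables.IsCoherent (R.restrictedYoneda.obj B) := by
  refine ⟨?_, ?_⟩
  · obtain ⟨Q, q, hQ, hq⟩ := hR B
    exact ⟨_, R.restrictedYoneda.map q, R.representables_obj hQ,
      (R.restrictedYoneda_epi_iff q).2 hq⟩
  · rintro P f ⟨P', hP', ⟨e⟩⟩
    obtain ⟨g, hg⟩ := (R.restrictedYoneda_map_bijective hP' B).2 (e.hom ≫ f)
    obtain ⟨N, i, h, hT⟩ := distinguished_cocone_triangle₁ g
    obtain ⟨Q, q, hQ, hq⟩ := hR N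
    have w : i ≫ g = 0 := comp_distTriang_mor_zero₁₂ _ hT
    have w' : (q ≫ i) ≫ g = 0 := by rw [Category.assoc, w, comp_zero]
    have ex : ((ShortComplex.mk _ _ w').map R.restrictedYoneda).Exact := by
      refine (R.restrictedYoneda_exact_iff _).2 fun P hP x hx ↦ ?_
      obtain ⟨y, hy⟩ := Triangle.coyoneda_exact₂ _ hT x hx
      obtain ⟨t, ht⟩ := hq hP y
      exact ⟨t, by rw [hy, ← ht]; exact (Category.assoc _ _ _).symm⟩
    have w'' : (R.restrictedYoneda.map (q ≫ i) ≫ e.hom) ≫ f = 0 := by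
      rw [Category.assoc, ← hg, ← Functor.map_comp, w', Functor.map_zero]
    refine ⟨_, _, w'', R.representables_obj hQ, ?_⟩
    have e' : (ShortComplex.mk _ _ w').map R.restrictedYoneda ≅ ShortComplex.mk _ _ w'' :=
      ShortComplex.isoMk (Iso.refl _) e (Iso.refl _) (Category.id_comp _)
        (hg.symm.trans (Category.comp_id _).symm)
    exact ShortComplex.exact_of_iso e' ex

/-- The conditions under which the coherent functors on `R` form an abelian category that contains
the representable ones. -/
class IsCovering (R : ObjectProperty T) : Prop where
  hasCovers : R.HasCovers
  biprod : ∀ ⦃P Q : T⦄, R P → R Q → R (P ⊞ Q)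
  zero : ∀ ⦃Z : T⦄, IsZero Z → R Z

namespace IsCovering

variable (R) [R.IsCovering]

lemma exists_isZero : ∃ Z : R.FullSubcategoryᵒᵖ ⥤ AddCommGrpCat.{v}, IsZero Z ∧
    R.representables Z := by
  obtain ⟨Z, hZ⟩ := HasZeroObject.zero (C := T)
  exact ⟨R.restrictedYoneda.obj Z, R.restrictedYoneda.map_isZero hZ, R.representables_obj (zero hZ)⟩

instance : R.representables.IsCoherent.ContainsZero := by
  obtain ⟨Z, hZ, hZ'⟩ := exists_isZero R
  exact containsZero_isCoherent hZ hZ'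

instance : R.representables.IsCoherent.IsClosedUnderFiniteProducts := by
  obtain ⟨Z, hZ, hZ'⟩ := exists_isZero R
  exact isClosedUnderFiniteProducts_isCoherent hZ hZ' (R.representables_biprod biprod)

instance : R.representables.IsCoherent.IsClosedUnderCokernels :=
  isClosedUnderCokernels_isCoherent (R.representables_biprod biprod)
    R.isRelativelyProjective_representables

/-- The restricted Yoneda functor with values in coherent functors. -/
def yoneda : T ⥤ R.Coherent :=
  ObjectProperty.lift _ R.restrictedYoneda hasCovers.isCoherent_obj

instance : R.representables.IsCoherent.ι.PreservesHomology where
  preservesKernels _ _ f := ObjectProperty.preservesKernels_ι _ f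
  preservesCokernels _ _ f := ObjectProperty.preservesCokernels_ι _ f

instance : (yoneda R).PreservesZeroMorphisms where
  map_zero A B := ObjectProperty.hom_ext _ (R.restrictedYoneda.map_zero A B)

instance : (yoneda R).IsHomological where
  exact S hS := (ShortComplex.exact_map_iff_of_faithful _ R.representables.IsCoherent.ι).1
    (R.restrictedYoneda.map_distinguished_exact S hS)

lemma yoneda_map_eq_zero_iff {A B : T} (f : A ⟶ B) : (yoneda R).map f = 0 ↔
    ∀ ⦃P : T⦄ (_ : R P) (x : P ⟶ A), x ≫ f = 0 := by
  rw [← R.restrictedYoneda_map_eq_zero_iff]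
  exact ⟨fun h ↦ congrArg (fun φ ↦ φ.hom) h, fun h ↦ ObjectProperty.hom_ext _ h⟩

variable {R}

lemma isRelProjective_yoneda {Q : T} (hQ : R Q) : (yoneda R).IsRelProjective Q where
  projective := ⟨fun {Y Z} g c hc ↦ by
    have := R.representables.IsCoherent.preservesEpimorphisms_ι_of_isNormalMonoCategory
    have : Epi c.hom := inferInstanceAs (Epi (R.representables.IsCoherent.ι.map c))
    obtain ⟨l, hl⟩ := R.isRelativelyProjective_representables.exists_lift
      (R.representables_obj hQ) Y.property c.hom g.hom
    exact ⟨ObjectProperty.homMk l, ObjectProperty.hom_ext _ hl⟩⟩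
  bijective B := by
    refine ⟨fun f g h ↦ (R.restrictedYoneda_map_bijective hQ B).1 (congrArg (fun φ ↦ φ.hom) h),
      fun φ ↦ ?_⟩
    obtain ⟨f, hf⟩ := (R.restrictedYoneda_map_bijective hQ B).2 φ.hom
    exact ⟨f, ObjectProperty.hom_ext _ hf⟩

variable (R) in
lemma hasRelCovers_yoneda : (yoneda R).HasRelCovers := fun X ↦ by
  obtain ⟨⟨P, p, ⟨Q, hQ, ⟨e⟩⟩, hp⟩, -⟩ := X.property
  let c : (yoneda R).obj Q ⟶ X := ObjectProperty.homMk (e.hom ≫ p)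
  refine ⟨Q, c, isRelProjective_yoneda hQ, R.representables.IsCoherent.ι.epi_of_epi_map ?_⟩
  exact inferInstanceAs (Epi (e.hom ≫ p))

/-- Coherent functors are thus indexed, up to isomorphism, by arrows of `T`, which bounds the
universe of objects. -/
lemma exists_cokernel_iso (X : R.Coherent) :
    ∃ f : Arrow T, Nonempty (cokernel ((yoneda R).map f.hom) ≅ X) := by
  obtain ⟨P⟩ := (hasRelCovers_yoneda R).nonempty_presentation X
  have := P.epi
  exact ⟨Arrow.mk P.a, ⟨(cokernelIsCokernel _).coconePointUniqueUpToIso P.exact.gIsCokernel⟩⟩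

end IsCovering

end Pretriangulated

end ObjectProperty

/-- A category equivalent to an abelian category is abelian. -/
@[reducible]
noncomputable def abelianOfEquiv {D : Type u} [Category.{v} D] {E : Type u'} [Category.{v'} E]
    [Abelian E] (e : D ≌ E) : Abelian D :=
  letI := Preadditive.ofFullyFaithful e.fullyFaithfulFunctor
  haveI : HasFiniteProducts D := ⟨fun _ ↦ Adjunction.hasLimitsOfShape_of_equivalence e.functor⟩
  abelianOfEquivalence e.functor

/-- A model of the category of coherent functors on `R` in prescribed universes. -/
lemma ObjectProperty.IsCovering.exists_model {T : Type u} [Category.{v} T] [Preadditive T]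
    [HasZeroObject T] [HasShift T ℤ] [∀ n : ℤ, (shiftFunctor T n).Additive] [Pretriangulated T]
    (R : ObjectProperty T) [R.IsCovering] :
    ∃ (D : Type (max u v w)) (_ : Category.{max v z} D), Nonempty (D ≌ R.Coherent) := by
  have : LocallySmall.{max v z} R.Coherent := ⟨fun X Y ↦ small_lift.{max u v, z, v} _⟩
  let obj : ULift.{max u v w} (Arrow T) → ShrinkHoms.{_} R.Coherent := fun f ↦
    ShrinkHoms.toShrinkHoms (cokernel ((yoneda R).map f.down.hom))
  have : (inducedFunctor obj).EssSurj := ⟨fun X ↦ by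
    obtain ⟨f, ⟨e⟩⟩ := exists_cokernel_iso (ShrinkHoms.fromShrinkHoms X)
    exact ⟨.up f, ⟨(ShrinkHoms.functor.{max v z} R.Coherent).mapIso e⟩⟩⟩
  have : (inducedFunctor obj).IsEquivalence := {}
  exact ⟨InducedCategory _ obj, inferInstance,
    ⟨(inducedFunctor obj).asEquivalence.trans (ShrinkHoms.equivalence.{max v z} R.Coherent).symm⟩⟩

end CategoryTheory

/-! ### Transfer of relative covers and lifting of projectives -/

namespace CategoryTheory.Functor

section Transfer

variable {T : Type u} [Category.{v} T] {C : Type u'} [Category.{v'} C] {F : T ⥤ C}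

lemma IsRelProjective.of_iso {F' : T ⥤ C} (e : F ≅ F') {Q : T} (hQ : F.IsRelProjective Q) :
    F'.IsRelProjective Q where
  projective := Projective.of_iso (e.app Q) hQ.projective
  bijective B := by
    refine ⟨fun f g h ↦ (hQ.bijective B).1 ?_, fun φ ↦ ?_⟩
    · rw [← NatIso.naturality_2 e f, h, NatIso.naturality_2 e g]
    · obtain ⟨f, hf⟩ := (hQ.bijective B).2 (e.hom.app Q ≫ φ ≫ e.inv.app B)
      exact ⟨f, by rw [← NatIso.naturality_1 e f, hf]; simp⟩

lemma HasRelCovers.of_iso {F' : T ⥤ C} (e : F ≅ F') (hF : F.HasRelCovers) :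
    F'.HasRelCovers := fun X ↦ by
  obtain ⟨Q, p, hQ, hp⟩ := hF X
  exact ⟨Q, e.inv.app Q ≫ p, hQ.of_iso e, inferInstance⟩

lemma IsRelProjective.comp_isEquivalence {D : Type u''} [Category.{v''} D] (Φ : C ⥤ D)
    [Φ.IsEquivalence] {Q : T} (hQ : F.IsRelProjective Q) : (F ⋙ Φ).IsRelProjective Q where
  projective := (Φ.asEquivalence.map_projective_iff _).2 hQ.projective
  bijective B :=
    (show Function.Bijective (Φ.map : (F.obj Q ⟶ F.obj B) → _) from
      ⟨Φ.map_injective, Φ.map_surjective⟩).comp (hQ.bijective B)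

lemma HasRelCovers.comp_isEquivalence {D : Type u''} [Category.{v''} D] (Φ : C ⥤ D)
    [Φ.IsEquivalence] (hF : F.HasRelCovers) : (F ⋙ Φ).HasRelCovers := fun X ↦ by
  obtain ⟨Q, p, hQ, hp⟩ := hF (Φ.objPreimage X)
  exact ⟨Q, Φ.map p ≫ (Φ.objObjPreimageIso X).hom, hQ.comp_isEquivalence Φ, inferInstance⟩

lemma HasRelCovers.enoughProjectives (hF : F.HasRelCovers) : EnoughProjectives C where
  presentation X := by
    obtain ⟨Q, p, hQ, hp⟩ := hF X
    exact ⟨{ p := F.obj Q, projective := hQ.projective, f := p, epi := hp }⟩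

lemma IsRelProjective.of_retract {Q Q' : T} (hQ : F.IsRelProjective Q) (r : Retract Q' Q) :
    F.IsRelProjective Q' where
  projective := by
    have := hQ.projective
    exact (r.map F).projective
  bijective B := by
    refine ⟨fun f g h ↦ ?_, fun φ ↦ ?_⟩
    · have := (hQ.bijective B).1 (a₁ := r.r ≫ f) (a₂ := r.r ≫ g) (by simp [h])
      simpa using r.i ≫= this
    · obtain ⟨f, hf⟩ := (hQ.bijective B).2 (F.map r.r ≫ φ)
      exact ⟨r.i ≫ f, by rw [F.map_comp, hf, ← F.map_comp_assoc, r.retract]; simp⟩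

/-- A projective `P` is a retract of some `F Q`. The corresponding idempotent lifts to an idempotent
of `Q` by bijectivity, and its splitting in `T` gives the required object. -/
lemma HasRelCovers.projectivesLift [IsIdempotentComplete T] (hF : F.HasRelCovers) :
    F.ProjectivesLift := fun P hP ↦ by
  obtain ⟨Q, p, hQ, hp⟩ := hF P
  let s := Projective.factorThru (𝟙 P) p
  have hs : s ≫ p = 𝟙 P := Projective.factorThru_comp _ _
  obtain ⟨e, he⟩ := (hQ.bijective Q).2 (p ≫ s)
  have hee : e ≫ e = e := (hQ.bijective Q).1 (by simp [he, reassoc_of% hs])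
  obtain ⟨Q', i, q, hiq, hqi⟩ := IsIdempotentComplete.idempotents_split Q e hee
  have h₁ : F.map i ≫ F.map q = 𝟙 _ := by rw [← F.map_comp, hiq, F.map_id]
  have h₂ : F.map q ≫ F.map i = p ≫ s := by rw [← F.map_comp, hqi, he]
  refine ⟨Q', hQ.of_retract ⟨i, q, hiq⟩, ⟨⟨F.map i ≫ p, s ≫ F.map q, ?_, ?_⟩⟩⟩
  · rw [Category.assoc, ← reassoc_of% h₂, reassoc_of% h₁, h₁]
  · rw [Category.assoc, reassoc_of% h₂, hs, Category.comp_id, hs]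

end Transfer

end CategoryTheory.Functor

/-! ### Ideals with enough projective objects -/

section

variable {T : Type u} [Category.{v} T] [Preadditive T]

namespace MorphismIdeal

variable {I : MorphismIdeal T}

lemma isProjective_iff {P : T} : I.IsProjective P ↔
    ∀ ⦃A B : T⦄ (f : A ⟶ B), f ∈ I.hom A B → ∀ x : P ⟶ A, x ≫ f = 0 := by
  refine forall₄_congr fun A B f _ ↦ ⟨fun h x ↦ ConcreteCategory.congr_hom h x, fun h ↦ ?_⟩
  ext x
  exact h x

lemma comp_mem_left {A B X : T} {f : A ⟶ B} (hf : f ∈ I.hom A B) (g : B ⟶ X) :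
    f ≫ g ∈ I.hom A X := by
  simpa using I.comp_mem (𝟙 A) f g hf

variable [HasZeroObject T] [HasShift T ℤ] [∀ n : ℤ, (shiftFunctor T n).Additive]
  [Pretriangulated T]

lemma HasEnoughProjectives.isCovering (hI : I.HasEnoughProjectives) :
    ObjectProperty.IsCovering (T := T) I.IsProjective where
  hasCovers A := by
    obtain ⟨P, π, hP, X, g, h, hT, hg⟩ := hI A
    refine ⟨P, π, hP, fun P' hP' x ↦ ?_⟩
    obtain ⟨y, hy⟩ := Triangle.coyoneda_exact₂ _ hT x (isProjective_iff.1 hP' g hg x)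
    exact ⟨y, hy.symm⟩
  biprod P Q hP hQ := isProjective_iff.2 fun A B f hf x ↦ by
    ext
    · simpa using isProjective_iff.1 hP f hf (biprod.inl ≫ x)
    · simpa using isProjective_iff.1 hQ f hf (biprod.inr ≫ x)
  zero Z hZ := isProjective_iff.2 fun A B f _ x ↦ hZ.eq_of_src _ _

/-- If `f` is killed by an `I`-epic `π : P ⟶ A`, it factors through the next map of the triangle,
which lies in `I`. -/
lemma HasEnoughProjectives.mem_iff (hI : I.HasEnoughProjectives) {A B : T} (f : A ⟶ B) :
    f ∈ I.hom A B ↔ ∀ ⦃P : T⦄ (_ : I.IsProjective P) (x : P ⟶ A), x ≫ f = 0 := by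
  refine ⟨fun hf P hP ↦ isProjective_iff.1 hP f hf, fun h ↦ ?_⟩
  obtain ⟨P, π, hP, X, g, h', hT, hg⟩ := hI A
  obtain ⟨k, rfl⟩ := Triangle.yoneda_exact₂ _ hT f (h hP π)
  exact comp_mem_left hg k

/-- Stability under both shifts is all that the proof of the theorem extracts from `I` being
homological; it is what makes the category of coherent functors stable. -/
lemma IsHomological.shift_mem (hI : IsHomological.{u, v, u'', v''} I) {A B : T} {f : A ⟶ B}
    (hf : f ∈ I.hom A B) : f⟦(1 : ℤ)⟧' ∈ I.hom _ _ ∧ f⟦(-1 : ℤ)⟧' ∈ I.hom _ _ := by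
  obtain ⟨D, _, _, _, G, rfl⟩ := hI
  rw [mem_kerStable_iff] at hf ⊢
  rw [mem_kerStable_iff]
  have key {X Y : T} (g : X ⟶ Y) : G.functor.map (g⟦(1 : ℤ)⟧') = 0 ↔ G.functor.map g = 0 := by
    have : (susp D).Additive := StableCategory.additive
    let σ (Z : T) : G.functor.obj (Z⟦(1 : ℤ)⟧) ≅ (susp D).obj (G.functor.obj Z) := G.suspIso.app Z
    have h : G.functor.map (g⟦(1 : ℤ)⟧') ≫ (σ Y).hom = (σ X).hom ≫ (susp D).map (G.functor.map g) :=
      G.suspIso.hom.naturality g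
    constructor
    · intro hg
      rw [hg, zero_comp] at h
      rw [← (susp D).map_eq_zero_iff, ← cancel_epi (σ X).hom, ← h, comp_zero]
    · intro hg
      rw [hg, Functor.map_zero, comp_zero] at h
      rw [← cancel_mono (σ Y).hom, h, zero_comp]
  refine ⟨(key f).2 hf, (key _).1 ?_⟩
  -- Desuspending and suspending `f` again gives `f` up to the counit.
  have := ((shiftEquiv T (1 : ℤ)).counitIso.hom.naturality f)
  change G.functor.map ((shiftEquiv T (1 : ℤ)).inverse ⋙ (shiftEquiv T (1 : ℤ)).functor |>.map f) = 0
  rw [← cancel_mono (G.functor.map ((shiftEquiv T (1 : ℤ)).counitIso.hom.app B)),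
    ← G.functor.map_comp, this, G.functor.map_comp, Functor.id_map, hf, comp_zero, zero_comp]

end MorphismIdeal

end

/-! ### The model of the universal functor and comparison with it -/

section

variable {T : Type u} [Category.{v} T] [Preadditive T]
  [HasZeroObject T] [HasShift T ℤ] [∀ n : ℤ, (shiftFunctor T n).Additive] [Pretriangulated T]

instance CategoryTheory.Functor.isHomological_shift_comp {C : Type u'} [Category.{v'} C]
    [Abelian C] (F : T ⥤ C) [F.IsHomological] (n : ℤ) : (shiftFunctor T n ⋙ F).IsHomological where
  exact S hS :=
    letI := Functor.ShiftSequence.tautological F ℤ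
    F.homologySequence_exact₂ S hS n

/-- The suspension of `D` and its inverse are the extensions along `F` of `F` precomposed with the
shifts by `1` and `-1`; they are mutually inverse because they are so on the image of `F`. -/
lemma CategoryTheory.Functor.HasRelCovers.exists_stable {D : Type u'} [Category.{v'} D] [Abelian D]
    {F : T ⥤ D} [F.IsHomological] (hF : F.HasRelCovers)
    (hk : ∀ ⦃A B : T⦄ (f : A ⟶ B), F.map f = 0 →
      F.map (f⟦(1 : ℤ)⟧') = 0 ∧ F.map (f⟦(-1 : ℤ)⟧') = 0) :
    ∃ (_ : StableCategory D) (F' : StableHomologicalFunctor T D), F'.functor = F := by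
  have h₁ : F.PreservesRelExact (shiftFunctor T (1 : ℤ) ⋙ F) :=
    hF.preservesRelExact fun A B f hf ↦ (hk f hf).1
  have h₂ : F.PreservesRelExact (shiftFunctor T (-1 : ℤ) ⋙ F) :=
    hF.preservesRelExact fun A B f hf ↦ (hk f hf).2
  have := (h₁.exact_extension hF).2
  have := (h₂.exact_extension hF).2
  let e₁ : F ⋙ h₁.extension hF ⋙ h₂.extension hF ≅ F ⋙ 𝟭 D :=
    Functor.isoWhiskerRight (h₁.extensionIso hF) (h₂.extension hF) ≪≫
      Functor.isoWhiskerLeft (shiftFunctor T (1 : ℤ)) (h₂.extensionIso hF) ≪≫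
      Functor.isoWhiskerRight (shiftEquiv T (1 : ℤ)).unitIso.symm F
  let e₂ : F ⋙ h₂.extension hF ⋙ h₁.extension hF ≅ F ⋙ 𝟭 D :=
    Functor.isoWhiskerRight (h₂.extensionIso hF) (h₁.extension hF) ≪≫
      Functor.isoWhiskerLeft (shiftFunctor T (-1 : ℤ)) (h₁.extensionIso hF) ≪≫
      Functor.isoWhiskerRight (shiftEquiv T (1 : ℤ)).counitIso F
  let stable : StableCategory D :=
    ⟨CategoryTheory.Equivalence.mk (h₁.extension hF) (h₂.extension hF) (hF.natIso e₁).symm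
      (hF.natIso e₂), inferInstanceAs (h₁.extension hF).Additive⟩
  exact ⟨stable, ⟨F, inferInstance, (h₁.extensionIso hF).symm⟩, rfl⟩

lemma MorphismIdeal.HasEnoughProjectives.exists_hasRelCovers {I : MorphismIdeal T}
    (hI : I.HasEnoughProjectives) (hI' : IsHomological.{u, v, u'', v''} I) :
    ∃ (D : Type (max u v w)) (_ : Category.{max v z} D) (_ : Abelian D) (_ : StableCategory D)
      (F : StableHomologicalFunctor T D), kerStable F = I ∧ F.functor.HasRelCovers := by
  have := hI.isCovering
  obtain ⟨D, _, ⟨e⟩⟩ :=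
    ObjectProperty.IsCovering.exists_model.{w, z} (T := T) (R := I.IsProjective)
  let : Abelian D := abelianOfEquiv e
  have : e.inverse.PreservesZeroMorphisms :=
    Functor.preservesZeroMorphisms_of_preserves_initial_object
  let Y := ObjectProperty.IsCovering.yoneda (T := T) I.IsProjective
  let F : T ⥤ D := Y ⋙ e.inverse
  have hF₀ {A B : T} (f : A ⟶ B) : F.map f = 0 ↔ f ∈ I.hom A B := by
    rw [hI.mem_iff, ← ObjectProperty.IsCovering.yoneda_map_eq_zero_iff]
    exact e.inverse.map_eq_zero_iff
  have : F.IsHomological :=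
    { toPreservesZeroMorphisms := inferInstanceAs (Y ⋙ e.inverse).PreservesZeroMorphisms
      exact := fun S hS ↦ (Y.map_distinguished_exact S hS).map e.inverse }
  have hF : F.HasRelCovers := (ObjectProperty.IsCovering.hasRelCovers_yoneda _).comp_isEquivalence _
  obtain ⟨_, F', hF'⟩ := hF.exists_stable fun A B f hf ↦ by
    simpa only [hF₀] using hI'.shift_mem ((hF₀ f).1 hf)
  refine ⟨D, inferInstance, inferInstance, inferInstance, F', ?_, hF' ▸ hF⟩
  ext A B f
  rw [mem_kerStable_iff, hF', hF₀]

section Composition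

variable {C : Type u'} [Category.{v'} C] [Abelian C] [StableCategory C]
  {D : Type u''} [Category.{v''} D] [Abelian D] [StableCategory D]
  {E : Type w} [Category.{z} E] [Abelian E] [StableCategory E]

/-- The composition of stable exact functors. -/
def StableExactFunctor.comp (H : StableExactFunctor C D) (K : StableExactFunctor D E) :
    StableExactFunctor C E where
  functor := H.functor ⋙ K.functor
  preservesFiniteLimits := inferInstance
  preservesFiniteColimits := inferInstance
  suspIso := Functor.isoWhiskerRight H.suspIso K.functor ≪≫
    Functor.isoWhiskerLeft H.functor K.suspIso

/-- The composition of factorizations. -/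
def StableFactorization.comp {F : StableHomologicalFunctor T C} {G : StableHomologicalFunctor T D}
    {K : StableHomologicalFunctor T E} (Φ : StableFactorization F G)
    (Ψ : StableFactorization G K) : StableFactorization F K where
  lift := Φ.lift.comp Ψ.lift
  iso := Functor.isoWhiskerRight Φ.iso Ψ.lift.functor ≪≫ Ψ.iso
  iso_susp A := by
    have h₁ := Φ.iso_susp A
    have h₂ := Ψ.iso_susp A
    have h₃ := Ψ.lift.suspIso.hom.naturality (Φ.iso.hom.app A)
    have h₄ := Ψ.lift.functor.congr_map h₁
    dsimp [StableExactFunctor.comp] at h₁ h₂ h₃ h₄ ⊢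
    simp only [Functor.map_comp, Category.assoc] at h₂ h₄ ⊢
    rw [h₂, reassoc_of% h₄, reassoc_of% h₃]

end Composition

/-- A stable abelian category is equivalent to one in larger universes. -/
lemma StableHomologicalFunctor.exists_factorization_isEquivalence
    {C : Type u'} [Category.{v'} C] [Abelian C] [StableCategory C]
    (F : StableHomologicalFunctor T C) :
    ∃ (D : Type (max u' w)) (_ : Category.{max v' z} D) (_ : Abelian D) (_ : StableCategory D)
      (G : StableHomologicalFunctor T D) (Φ : StableFactorization F G),
      Φ.lift.functor.IsEquivalence := by
  obtain ⟨D, _, ⟨e⟩⟩ : ∃ (D : Type (max u' w)) (_ : Category.{max v' z} D), Nonempty (C ≌ D) :=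
    ⟨_, _, ⟨ULiftHomULiftCategory.equiv.{z, w} C⟩⟩
  let : Abelian D := abelianOfEquiv e.symm
  have : e.functor.PreservesZeroMorphisms :=
    Functor.preservesZeroMorphisms_of_preserves_initial_object
  have : e.inverse.PreservesZeroMorphisms :=
    Functor.preservesZeroMorphisms_of_preserves_initial_object
  have : e.functor.Additive := Functor.additive_of_preserves_binary_products _
  have : e.inverse.Additive := Functor.additive_of_preserves_binary_products _
  have : (susp C).Additive := StableCategory.additive
  let : StableCategory D :=
    ⟨e.symm.trans (StableCategory.suspEquiv.trans e),
      inferInstanceAs (e.inverse ⋙ susp C ⋙ e.functor).Additive⟩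
  let σ : susp C ⋙ e.functor ≅ e.functor ⋙ susp D :=
    Functor.isoWhiskerRight e.unitIso (susp C ⋙ e.functor)
  let G : StableHomologicalFunctor T D :=
    { functor := F.functor ⋙ e.functor
      isHomological :=
        { exact := fun S hS ↦ (F.functor.map_distinguished_exact S hS).map e.functor }
      suspIso := Functor.isoWhiskerRight F.suspIso e.functor ≪≫
        Functor.isoWhiskerLeft F.functor σ }
  refine ⟨D, inferInstance, inferInstance, inferInstance, G,
    { lift := ⟨e.functor, inferInstance, inferInstance, σ⟩
      iso := Iso.refl _
      iso_susp := fun A ↦ ?_ }, e.isEquivalence_functor⟩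
  dsimp [G]
  simp

/-- The model `F₀` and `F` are both universal, so the induced functors between their targets are
mutually inverse. Kernel and relative covers then pass from `F₀` to `F`. -/
lemma IsUniversalExact.hasRelCovers {C : Type u'} [Category.{v'} C] [Abelian C] [StableCategory C]
    {I : MorphismIdeal T} (hI : MorphismIdeal.IsHomological.{u, v, u'', v''} I)
    {F : StableHomologicalFunctor T C} (hF : IsUniversalExact.{max u v u' w, max v v' z} I F)
    (h : I.HasEnoughProjectives) : MorphismIdeal.kerStable F = I ∧ F.functor.HasRelCovers := by
  obtain ⟨D, _, _, _, F₀, rfl, hF₀⟩ := h.exists_hasRelCovers.{max u' w, max v' z} hI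
  obtain ⟨Φ⟩ := hF.exists_factorization D F₀ (fun _ _ _ hf ↦ hf)
  obtain ⟨Ψ⟩ := (isUniversalExact_of_hasRelCovers F₀ hF₀).exists_factorization C F hF.isExact
  -- Universality of `F` is only available for targets in fixed, larger universes. Uniqueness is
  -- therefore applied to a copy `C'` of `C` there, and the equivalence `Υ` is cancelled afterwards.
  obtain ⟨C', _, _, _, G, Υ, hΥ⟩ :=
    F.exists_factorization_isEquivalence.{max u v w, max v z}
  have hG : (MorphismIdeal.kerStable F₀).IsExact G.functor := fun A B f hf ↦ by
    rw [← NatIso.naturality_1 Υ.iso f, Functor.comp_map, hF.isExact f hf]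
    simp
  obtain ⟨θ, -⟩ := hF.unique C' G hG Υ ((Φ.comp Ψ).comp Υ)
  have e₁ : 𝟭 C ≅ Φ.lift.functor ⋙ Ψ.lift.functor :=
    Functor.fullyFaithfulCancelRight Υ.lift.functor θ
  have e₂ : Ψ.lift.functor ⋙ Φ.lift.functor ≅ 𝟭 D :=
    hF₀.natIso (Functor.isoWhiskerRight Ψ.iso Φ.lift.functor ≪≫ Φ.iso)
  have : Ψ.lift.functor.IsEquivalence :=
    (CategoryTheory.Equivalence.mk Ψ.lift.functor Φ.lift.functor e₂.symm e₁.symm).isEquivalence_functor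
  refine ⟨?_, (hF₀.comp_isEquivalence _).of_iso Ψ.iso⟩
  ext A B f
  refine ⟨fun hf ↦ ?_, hF.isExact f⟩
  have hf' : F.functor.map f = 0 := hf
  change F₀.functor.map f = 0
  rw [← NatIso.naturality_1 Φ.iso f, Functor.comp_map, hf']
  simp

end

theorem theorem3 {T : Type u} [Category.{v} T] [Preadditive T] [HasZeroObject T]
    [HasShift T ℤ] [∀ n : ℤ, (shiftFunctor T n).Additive] [Pretriangulated T] [IsTriangulated T]
    [IsIdempotentComplete T]
    {C : Type u'} [Category.{v'} C] [Abelian C] [StableCategory C]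
    (I : MorphismIdeal T) (hI : MorphismIdeal.IsHomological.{u, v, u'', v''} I)
    (F : StableHomologicalFunctor T C) (hF : I.IsExact F.functor) :
    (IsUniversalExact.{max u v u' w, max v v' z} I F ∧ I.HasEnoughProjectives) ↔
      (MorphismIdeal.kerStable F = I ∧
        EnoughProjectives C ∧
        ∃ h : isProjective C ≤ F.functor.leftAdjointObjIsDefined,
          Nonempty (ObjectProperty.ιOfLE h ⋙ F.functor.partialLeftAdjoint ⋙ F.functor ≅
            (isProjective C).ι)) := by
  rw [← Functor.projectivesLift_iff]
  constructor
  · rintro ⟨h, h'⟩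
    obtain ⟨h₁, h₂⟩ := h.hasRelCovers hI h'
    exact ⟨h₁, h₂.enoughProjectives, h₂.projectivesLift⟩
  · rintro ⟨rfl, h₁, h₂⟩
    exact ⟨isUniversalExact_of_hasRelCovers F h₂.hasRelCovers,
      MorphismIdeal.hasEnoughProjectives_of_hasRelCovers F h₂.hasRelCovers⟩
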